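/- For complex $\alpha_1,\dots,\alpha_p$ and $\beta_1,\dots,\beta_q$, none of the $\beta_j$ in $\mathbb Z_{\le 0}=\{0,-1,-2,\dots\}$, write $${}_pF_q\biggl[\begin{matrix}\alpha_1,\dots,\alpha_p\\ \beta_1,\dots,\beta_q\end{matrix};z\biggr]=\sum_{k=0}^\infty\frac{(\alpha_1)_k\cdots(\alpha_p)_k}{(\beta_1)_k\cdots(\beta_q)_k\,k!}\,z^k,\qquad (x)_k=x(x+1)\cdots(x+k-1).$$ **(i)** Let $a,b,c\in\mathbb C$ satisfy $\operatorname{Re}(-3a+2b+2c)>0$ and $\operatorname{Re}(-2a+2b+2c+1)>0$. Assume that none of the lower parameters of the two series below, and none of the arguments of the Gamma functions in the numerators below, lies in $\mathbb Z_{\le0}$ (with $1/\Gamma(x)=0$ for $x\in\mathbb Z_{\le 0}$ in the denominators). Then both series converge absolutely and $${}_3F_2\biggl[\begin{matrix}a,\,b,\,c\\-a+2b+c,\,-a+b+2c\end{matrix};1\biggr] =\frac{\Gamma(-\frac a2+b+c+\frac12)\,\Gamma(-\frac{3a}2+2b+c+\frac12)}{\Gamma(-a+b+c+\frac12)\,\Gamma(-a+2b+c+\frac12)}$$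 $$\times\frac{\Gamma(-a+b+2c)\,\Gamma(-3a+2b+2c)\,\Gamma(-2a+2b+2c)\,\Gamma(-2a+4b+2c)}{\Gamma(-\frac{3a}2+b+2c)\,\Gamma(-\frac{5a}2+2b+2c)\,\Gamma(-a+2b+2c)\,\Gamma(-3a+4b+2c)}$$ $$\times{}_5F_4\biggl[\begin{matrix}-2a+2b+2c-1,\,c-\frac a2,\,-\frac{3a}2+b+c,\,\frac a2,\,b-\frac a2\\-\frac{3a}2+2b+c,\,-\frac a2+b+c,\,-\frac{5a}2+2b+2c,\,-\frac{3a}2+b+2c\end{matrix};1\biggr].$$ **(ii)** For every integer $n\ge0$ (the case $a=b=c=2n+1$ of (i)), $$\frac{\Gamma(4n+2)^2\,\Gamma(2n+1)^2}{\Gamma(3n+\frac32)^4}\,{}_5F_4\biggl[\begin{matrix}4n+1,\,n+\frac12,\,n+\frac12,\,n+\frac12,\,n+\frac12\\3n+\frac32,\,3n+\frac32,\,3n+\frac32,\,3n+\frac32\end{matrix};1\biggr]={}_3F_2\biggl[\begin{matrix}2n+1,\,2n+1,\,2n+1\\4n+2,\,4n+2\end{matrix};1\biggr].$$ Moreover the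 series $$r_n=\sum_{t=1}^\infty\frac{2^{8n}\,n!^4\,(2n)!^2\prod_{j=0}^{4n-1}(t-n+j)}{(4n)!\,\prod_{j=0}^{2n}(t-\frac12+j)^4}$$ converges absolutely and $$r_n=\frac{\pi^2\,\Gamma(2n+1)^6}{\Gamma(3n+\frac32)^4}\,{}_5F_4\biggl[\begin{matrix}4n+1,\,n+\frac12,\,n+\frac12,\,n+\frac12,\,n+\frac12\\3n+\frac32,\,3n+\frac32,\,3n+\frac32,\,3n+\frac32\end{matrix};1\biggr] =\frac{\pi^2(2n)!^4}{(4n+1)!^2}\,{}_3F_2\biggl[\begin{matrix}2n+1,\,2n+1,\,2n+1\\4n+2,\,4n+2\end{matrix};1\biggr]$$ $$=\pi^2\bigl(q_{2n}\,\zeta(2)-p_{2n}\bigr),$$ where $p_m/q_m$ are Apéry's approximations to $\zeta(2)$: $(q_m)$ and $(p_m)$ are the rational solutions of $(m+1)^2u_{m+1}=(11m^2+11m+3)u_m+m^2u_{m-1}$ ($m\ge1$) with $q_0=1$, $q_1=3$ and $p_0=0$, $p_1=5$. In particular $r_n\in\mathbb Q\pi^4+\mathbb Q\pi^2$. -/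

import Mathlib

noncomputable section

/-- The `k`-th term `(a₁)_k ⋯ (a_p)_k / ((b₁)_k ⋯ (b_q)_k k!) · z ^ k` of the generalized
hypergeometric series with upper parameters `as` and lower parameters `bs`. -/
def hypergeometricTerm (as bs : List ℂ) (z : ℂ) (k : ℕ) : ℂ :=
  (as.map fun x => (ascPochhammer ℂ k).eval x).prod /
    ((bs.map fun x => (ascPochhammer ℂ k).eval x).prod * (k.factorial : ℂ)) * z ^ k

/-- The generalized hypergeometric series `pFq[as; bs; z]`. -/
def hypergeometricF (as bs : List ℂ) (z : ℂ) : ℂ :=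
  ∑' k : ℕ, hypergeometricTerm as bs z k

/-- `x` is not one of `0, -1, -2, …`. -/
def NotNonposInt (x : ℂ) : Prop := ∀ m : ℕ, x ≠ -(m : ℂ)

/-- The rational function
`R_n(t) = 2^(8n) n!^4 (2n)!^2 ∏_{j=0}^{4n-1} (t-n+j) / ((4n)! ∏_{j=0}^{2n} (t-1/2+j)^4)`. -/
def wellPoisedR (n : ℕ) (t : ℂ) : ℂ :=
  (2 ^ (8 * n) * (n.factorial : ℂ) ^ 4 * ((2 * n).factorial : ℂ) ^ 2 *
      ∏ j ∈ Finset.range (4 * n), (t - n + j)) /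
    (((4 * n).factorial : ℂ) * ∏ j ∈ Finset.range (2 * n + 1), (t - 1 / 2 + j) ^ 4)

/-- `r_n = ∑_{t=1}^∞ R_n(t)`. -/
def wellPoisedForm (n : ℕ) : ℂ := ∑' t : ℕ, wellPoisedR n ((t : ℂ) + 1)

/-- The solution of Apéry's recurrence for `ζ(2)`,
`(m+1)² u_{m+1} = (11m² + 11m + 3) u_m + m² u_{m-1}` for `m ≥ 1`, with given `u_0`, `u_1`. -/
def aperySolution (u₀ u₁ : ℚ) : ℕ → ℚ
  | 0 => u₀
  | 1 => u₁
  | m + 2 =>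
    ((11 * ((m : ℚ) + 1) ^ 2 + 11 * ((m : ℚ) + 1) + 3) * aperySolution u₀ u₁ (m + 1) +
      ((m : ℚ) + 1) ^ 2 * aperySolution u₀ u₁ m) / ((m : ℚ) + 2) ^ 2

/-- Denominators of Apéry's approximations to `ζ(2)`: `1, 3, 19, 147, …`. -/
def aperyDen : ℕ → ℚ := aperySolution 1 3

/-- Numerators of Apéry's approximations to `ζ(2)`: `0, 5, 125/4, …`. -/
def aperyNum : ℕ → ℚ := aperySolution 0 5

end

/-!
Put `h = -a + b + c`, `x = c - a / 2` and `y = a / 2`. Creative telescoping gives contiguous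
relations under `h ↦ h + 1`: the sum of the `₃F₂` and that of a companion series satisfy a pair of
first-order linear recurrences, and the `₅F₄` and a companion, scaled by Gamma factors, satisfy the
same pair. As `h → ∞` all these series tend to `1`, while the Casoratian of the two solutions,
suitably normalized, is eventually expanded by the recurrence; it must therefore vanish, and the
solutions agree. Working with `1 / Γ(b + k)` in place of `1 / (b)_k` makes the relations polynomial
identities, free of poles. Legendre's duplication formula brings the Gamma factors into the stated
form.

For `a = b = c = 2n + 1` the `₅F₄` is, term by term, the series `r_n`: the first `n` terms of `r_n`
vanish, and the remaining ones are the hypergeometric terms up to a constant. The series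
`₃F₂[m + 1, m + 1, m + 1; 2m + 2, 2m + 2; 1]` satisfies Apéry's recurrence in `m`, by Zeilberger's
algorithm, with initial values that are explicit combinations of `1` and `ζ(2)`.
-/

section

open Filter Topology Asymptotics

/-! ### Pochhammer symbols and the reciprocal Gamma function -/

/-- The Pochhammer symbol `(a)_k = a (a + 1) ⋯ (a + k - 1)`. -/
noncomputable def poch (a : ℂ) (k : ℕ) : ℂ := (ascPochhammer ℂ k).eval a

@[simp]
theorem poch_zero (a : ℂ) : poch a 0 = 1 := by simp [poch]

theorem poch_succ (a : ℂ) (k : ℕ) : poch a (k + 1) = poch a k * (a + k) :=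
  ascPochhammer_succ_eval k a

theorem poch_succ_left (a : ℂ) (k : ℕ) : poch a (k + 1) = a * poch (a + 1) k := by
  simp [poch, ascPochhammer_succ_left]

theorem prod_range_add_eq_poch (a : ℂ) (n : ℕ) :
    ∏ j ∈ Finset.range n, (a + j) = poch a n := by
  induction n with
  | zero => simp
  | succ n ih => rw [Finset.prod_range_succ, ih, poch_succ]

theorem poch_add_one_mul (a : ℂ) (k : ℕ) : a * poch (a + 1) k = (a + k) * poch a k := by
  rw [← poch_succ_left, poch_succ, mul_comm]

namespace NotNonposInt

theorem of_re_pos {a : ℂ} (ha : 0 < a.re) : NotNonposInt a := by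
  rintro m rfl
  have : (0 : ℝ) ≤ m := m.cast_nonneg
  simp only [Complex.neg_re, Complex.natCast_re] at ha
  linarith

theorem add_natCast {a : ℂ} (ha : NotNonposInt a) (n : ℕ) : NotNonposInt (a + n) :=
  fun m h => ha (n + m) (by push_cast; linear_combination h)

theorem add_natCast_ne_zero {a : ℂ} (ha : NotNonposInt a) (n : ℕ) : a + n ≠ 0 :=
  fun h => ha n (by linear_combination h)

theorem ne_zero {a : ℂ} (ha : NotNonposInt a) : a ≠ 0 := by simpa using ha 0

theorem Gamma_ne_zero {a : ℂ} (ha : NotNonposInt a) : Complex.Gamma a ≠ 0 :=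
  Complex.Gamma_ne_zero ha

end NotNonposInt

theorem inv_Gamma_add_natCast (a : ℂ) (k : ℕ) :
    (Complex.Gamma (a + k))⁻¹ = (a + k) * (Complex.Gamma (a + (k + 1 : ℕ)))⁻¹ := by
  rw [Complex.one_div_Gamma_eq_self_mul_one_div_Gamma_add_one, Nat.cast_succ, add_assoc]

theorem inv_Gamma_add_natCast_eq_add_one (a : ℂ) (k : ℕ) :
    (Complex.Gamma (a + k))⁻¹ = (a + k) * (Complex.Gamma (a + 1 + k))⁻¹ := by
  rw [Complex.one_div_Gamma_eq_self_mul_one_div_Gamma_add_one, add_right_comm]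

theorem add_natCast_succ (a : ℂ) (k : ℕ) : a + (k + 1 : ℕ) = a + 1 + k := by
  push_cast
  ring

theorem inv_factorial_eq_add_one_mul (k : ℕ) :
    (k.factorial : ℂ)⁻¹ = (k + 1) * ((k + 1).factorial : ℂ)⁻¹ := by
  have hk : (k : ℂ) + 1 ≠ 0 := by exact_mod_cast k.succ_ne_zero
  rw [Nat.factorial_succ, Nat.cast_mul, Nat.cast_succ, mul_inv, mul_inv_cancel_left₀ hk]

theorem poch_mul_inv_Gamma_add_natCast (a : ℂ) (k : ℕ) :
    poch a k * (Complex.Gamma (a + k))⁻¹ = (Complex.Gamma a)⁻¹ := by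
  induction k with
  | zero => simp
  | succ k ih => rw [← ih, inv_Gamma_add_natCast a k, poch_succ, mul_assoc]

theorem Gamma_add_natCast {a : ℂ} (ha : NotNonposInt a) (k : ℕ) :
    Complex.Gamma (a + k) = Complex.Gamma a * poch a k := by
  have h := poch_mul_inv_Gamma_add_natCast a k
  have h₁ := ha.Gamma_ne_zero
  have h₂ := (ha.add_natCast k).Gamma_ne_zero
  field_simp at h
  rw [← h, mul_comm]

theorem Gamma_add_two {z : ℂ} (hz : 0 < z.re) :
    Complex.Gamma (z + 2) = z * (z + 1) * Complex.Gamma z := by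
  have hz' := NotNonposInt.of_re_pos hz
  have hone : z + 1 ≠ 0 := by simpa using hz'.add_natCast_ne_zero 1
  rw [show z + 2 = z + 1 + 1 by ring, Complex.Gamma_add_one _ hone,
    Complex.Gamma_add_one _ hz'.ne_zero]
  ring

theorem eventually_notNonposInt_add_natCast (a : ℂ) :
    ∀ᶠ n : ℕ in atTop, NotNonposInt (a + n) := by
  obtain ⟨N, hN⟩ := exists_nat_gt (-a.re)
  filter_upwards [eventually_ge_atTop N] with n hn
  refine NotNonposInt.of_re_pos ?_
  have : (N : ℝ) ≤ n := by exact_mod_cast hn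
  simp only [Complex.add_re, Complex.natCast_re]
  linarith

/-! ### Growth of regularized hypergeometric terms -/

/-- The ratio `n ^ a n! / Γ(a + n + 1)` tends to `1`: for admissible `a` this is Gauss's product
formula, and the ratios for `a` and `a + 1` differ by the factor `(a + n + 1) / n`. -/
theorem tendsto_cpow_mul_factorial_mul_inv_Gamma (a : ℂ) :
    Tendsto (fun n : ℕ => (n : ℂ) ^ a * n.factorial * (Complex.Gamma (a + (n + 1 : ℕ)))⁻¹) atTop
      (𝓝 1) := by
  obtain ⟨m, hm⟩ := (eventually_notNonposInt_add_natCast a).exists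
  induction m generalizing a with
  | zero =>
    rw [Nat.cast_zero, add_zero] at hm
    have h := (Complex.GammaSeq_tendsto_Gamma a).mul_const (Complex.Gamma a)⁻¹
    rw [mul_inv_cancel₀ hm.Gamma_ne_zero] at h
    refine h.congr fun n => ?_
    rw [Complex.GammaSeq, prod_range_add_eq_poch, Gamma_add_natCast hm, mul_inv]
    ring
  | succ m ih =>
    have h₁ := ih (a + 1) (by convert hm using 1; push_cast; ring)
    have h₂ : Tendsto (fun n : ℕ => 1 + (a + 1) / (n : ℂ)) atTop (𝓝 1) := by
      simpa using (tendsto_const_div_atTop_nhds_zero_nat (a + 1)).const_add 1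
    have h := h₁.mul h₂
    rw [mul_one] at h
    refine h.congr' ?_
    filter_upwards [eventually_gt_atTop 0] with n hn
    have hn' : (n : ℂ) ≠ 0 := by exact_mod_cast hn.ne'
    rw [inv_Gamma_add_natCast a (n + 1), Complex.cpow_add _ _ hn', Complex.cpow_one,
      show a + 1 + ((n + 1 : ℕ) : ℂ) = a + (n + 1 + 1 : ℕ) by push_cast; ring]
    push_cast
    field_simp
    ring

theorem tendsto_poch_mul_inv_cpow_mul_factorial (a : ℂ) :
    Tendsto (fun n : ℕ => poch a (n + 1) * ((n : ℂ) ^ a * n.factorial)⁻¹) atTop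
      (𝓝 (Complex.Gamma a)⁻¹) := by
  have h := (tendsto_cpow_mul_factorial_mul_inv_Gamma a).inv₀ one_ne_zero
  have h := h.const_mul (Complex.Gamma a)⁻¹
  rw [inv_one, mul_one] at h
  refine h.congr' ?_
  filter_upwards [(tendsto_add_atTop_nat 1).eventually (eventually_notNonposInt_add_natCast a)]
    with n hn
  rw [mul_inv, inv_inv, ← poch_mul_inv_Gamma_add_natCast a (n + 1), mul_left_comm,
    mul_assoc (poch _ _), inv_mul_cancel₀ hn.Gamma_ne_zero, mul_one, mul_comm]

/-- The term `(a₁)_k ⋯ (a_p)_k / (Γ(b₁ + k) ⋯ Γ(b_q + k) k!)` of the regularized hypergeometric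
series at `1`. As `1 / Γ` is entire, the contiguous relations between such terms are polynomial
identities, valid for all complex parameters. -/
noncomputable def regularizedTerm (as bs : List ℂ) (k : ℕ) : ℂ :=
  (as.map fun a => poch a k).prod * (bs.map fun b => (Complex.Gamma (b + k))⁻¹).prod *
    (k.factorial : ℂ)⁻¹

theorem regularizedTerm_zero (as bs : List ℂ) :
    regularizedTerm as bs 0 = (bs.map fun b => (Complex.Gamma b)⁻¹).prod := by
  simp [regularizedTerm]

theorem hypergeometricTerm_one_eq {as bs : List ℂ} (hbs : ∀ b ∈ bs, NotNonposInt b) (k : ℕ) :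
    hypergeometricTerm as bs 1 k = (bs.map Complex.Gamma).prod * regularizedTerm as bs k := by
  have h : (bs.map fun b => poch b k).prod⁻¹ =
      (bs.map Complex.Gamma).prod * (bs.map fun b => (Complex.Gamma (b + k))⁻¹).prod := by
    rw [List.prod_inv, List.map_map, ← List.prod_map_mul]
    refine congrArg List.prod (List.map_congr_left fun b hb => ?_)
    rw [Gamma_add_natCast (hbs b hb), mul_inv, mul_inv_cancel_left₀ (hbs b hb).Gamma_ne_zero,
      Function.comp_apply]
  simp only [poch] at h
  rw [hypergeometricTerm, div_eq_mul_inv, mul_inv, h, regularizedTerm, one_pow]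
  simp only [poch]
  ring

theorem tendsto_regularizedTerm_mul {as bs : List ℂ} (hlen : as.length = bs.length + 1) :
    Tendsto (fun n : ℕ => regularizedTerm as bs (n + 1) *
      ((n : ℂ) ^ (bs.sum - as.sum) * (n + 1))) atTop
      (𝓝 (as.map fun a => (Complex.Gamma a)⁻¹).prod) := by
  have hscale (n : ℕ) (hn : (n : ℂ) ≠ 0) (l : List ℂ) :
      (l.map fun a => (n : ℂ) ^ a * n.factorial).prod =
        (n : ℂ) ^ l.sum * (n.factorial : ℂ) ^ l.length := by
    induction l with
    | nil => simp
    | cons a l ih =>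
      rw [List.map_cons, List.prod_cons, ih, List.sum_cons, List.length_cons,
        Complex.cpow_add _ _ hn]
      ring
  have ha := tendsto_list_prod as fun a _ => tendsto_poch_mul_inv_cpow_mul_factorial a
  have hb := tendsto_list_prod bs fun b _ => tendsto_cpow_mul_factorial_mul_inv_Gamma b
  have h := ha.mul hb
  simp only [List.map_const', List.prod_replicate, one_pow, mul_one] at h
  refine h.congr' ?_
  filter_upwards [eventually_gt_atTop 0] with n hn
  have hn' : (n : ℂ) ≠ 0 := by exact_mod_cast hn.ne'
  have hf : (n.factorial : ℂ) ≠ 0 := by exact_mod_cast n.factorial_ne_zero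
  have hn₁ : (n : ℂ) + 1 ≠ 0 := by exact_mod_cast n.succ_ne_zero
  have hpow : (n : ℂ) ^ as.sum ≠ 0 := by simp [Complex.cpow_eq_zero_iff, hn']
  have hinv := List.prod_inv (as.map fun a => (n : ℂ) ^ a * n.factorial)
  rw [List.map_map, Function.comp_def] at hinv
  rw [List.prod_map_mul, List.prod_map_mul, ← hinv, hscale n hn', hscale n hn', regularizedTerm,
    Complex.cpow_sub _ _ hn', hlen, Nat.factorial_succ]
  push_cast
  field_simp
  ring

theorem regularizedTerm_succ_isBigO {as bs : List ℂ} (hlen : as.length = bs.length + 1) :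
    (fun n : ℕ => regularizedTerm as bs (n + 1)) =O[atTop]
      fun n : ℕ => (n : ℝ) ^ ((as.sum - bs.sum).re - 1) := by
  have hdecay : (fun n : ℕ => ((n : ℂ) ^ (bs.sum - as.sum) * (n + 1))⁻¹) =O[atTop]
      fun n : ℕ => (n : ℝ) ^ ((as.sum - bs.sum).re - 1) := by
    refine IsBigO.of_bound 1 ?_
    filter_upwards [eventually_gt_atTop 0] with n hn
    have hn' : (0 : ℝ) < n := by exact_mod_cast hn
    have hnorm : ‖(n : ℂ) + 1‖ = (n : ℝ) + 1 := by exact_mod_cast Complex.norm_natCast (n + 1)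
    rw [norm_inv, norm_mul, hnorm, Complex.norm_natCast_cpow_of_pos hn, one_mul, mul_inv,
      ← Real.rpow_neg hn'.le, ← Complex.neg_re, neg_sub, Real.rpow_sub_one hn'.ne',
      Real.norm_of_nonneg (by positivity), div_eq_mul_inv]
    gcongr
    linarith
  have h := ((tendsto_regularizedTerm_mul hlen).isBigO_one ℝ).mul hdecay
  simp only [one_mul] at h
  refine h.congr' ?_ EventuallyEq.rfl
  filter_upwards [eventually_gt_atTop 0] with n hn
  have hn' : (n : ℂ) ≠ 0 := by exact_mod_cast hn.ne'
  have hn₁ : (n : ℂ) + 1 ≠ 0 := by exact_mod_cast n.succ_ne_zero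
  exact mul_inv_cancel_right₀ (mul_ne_zero (by simp [Complex.cpow_eq_zero_iff, hn']) hn₁) _

theorem summable_regularizedTerm {as bs : List ℂ} (hlen : as.length = bs.length + 1)
    (hs : 0 < (bs.sum - as.sum).re) : Summable (regularizedTerm as bs) := by
  rw [← summable_nat_add_iff 1]
  refine summable_of_isBigO_nat (Real.summable_nat_rpow.2 ?_) (regularizedTerm_succ_isBigO hlen)
  rw [Complex.sub_re] at hs ⊢
  linarith

theorem tendsto_add_one_pow_mul_regularizedTerm {as bs : List ℂ}
    (hlen : as.length = bs.length + 1) {i : ℕ} (hs : i < (bs.sum - as.sum).re + 1) :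
    Tendsto (fun n : ℕ => ((n : ℂ) + 1) ^ i * regularizedTerm as bs n) atTop (𝓝 0) := by
  rw [← tendsto_add_atTop_iff_nat 1]
  have hpow : (fun n : ℕ => (((n + 1 : ℕ) : ℂ) + 1) ^ i) =O[atTop]
      fun n : ℕ => (n : ℝ) ^ (i : ℝ) := by
    refine IsBigO.of_bound (3 ^ i) ?_
    filter_upwards [eventually_gt_atTop 0] with n hn
    have hn' : (1 : ℝ) ≤ n := by exact_mod_cast hn
    have hnorm : ‖((n + 1 : ℕ) : ℂ) + 1‖ = (n : ℝ) + 2 := by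
      rw [← Nat.cast_succ, Complex.norm_natCast]
      push_cast
      ring
    rw [norm_pow, hnorm, Real.rpow_natCast, norm_pow, ← mul_pow,
      Real.norm_of_nonneg (by positivity)]
    gcongr
    linarith
  refine (hpow.mul (regularizedTerm_succ_isBigO hlen)).trans_tendsto ?_
  have hlim : Tendsto (fun n : ℕ => (n : ℝ) ^ (-((bs.sum - as.sum).re + 1 - i))) atTop (𝓝 0) :=
    (tendsto_rpow_neg_atTop (by linarith)).comp tendsto_natCast_atTop_atTop
  refine hlim.congr' ?_
  filter_upwards [eventually_gt_atTop 0] with n hn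
  rw [← Real.rpow_add (by exact_mod_cast hn)]
  congr 1
  simp only [Complex.sub_re]
  ring

theorem tendsto_eval_mul_regularizedTerm {as bs : List ℂ} (hlen : as.length = bs.length + 1)
    {q : Polynomial ℂ} (hq : q.natDegree < (bs.sum - as.sum).re + 1) :
    Tendsto (fun k : ℕ => q.eval ((k : ℂ) + 1) * regularizedTerm as bs k) atTop (𝓝 0) := by
  have h := tendsto_finsetSum (Finset.range (q.natDegree + 1)) fun i hi =>
    (tendsto_add_one_pow_mul_regularizedTerm hlen (i := i) <| lt_of_le_of_lt
      (by exact_mod_cast Finset.mem_range_succ_iff.1 hi) hq).const_mul (q.coeff i)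
  simp only [mul_zero, Finset.sum_const_zero] at h
  refine h.congr fun k => ?_
  rw [Polynomial.eval_eq_sum_range, Finset.sum_mul]
  exact Finset.sum_congr rfl fun i _ => (mul_assoc _ _ _).symm

theorem tendsto_regularizedTerm {as bs : List ℂ} (hlen : as.length = bs.length + 1)
    (hs : -1 < (bs.sum - as.sum).re) : Tendsto (regularizedTerm as bs) atTop (𝓝 0) := by
  simpa only [pow_zero, one_mul] using
    tendsto_add_one_pow_mul_regularizedTerm hlen (i := 0) (by rw [Nat.cast_zero]; linarith)

theorem tendsto_linear_mul_regularizedTerm {as bs : List ℂ}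
    (hlen : as.length = bs.length + 1) (hs : 0 < (bs.sum - as.sum).re) (c d : ℂ) :
    Tendsto (fun k : ℕ => (c + d * k) * regularizedTerm as bs k) atTop (𝓝 0) := by
  have hzero := tendsto_regularizedTerm hlen (by linarith)
  have hone := tendsto_add_one_pow_mul_regularizedTerm hlen (i := 1)
    (by rw [Nat.cast_one]; linarith)
  have h := (hzero.const_mul (c - d)).add (hone.const_mul d)
  simp only [mul_zero, add_zero] at h
  exact h.congr fun k => by ring

theorem summable_hypergeometricTerm {as bs : List ℂ} (hlen : as.length = bs.length + 1)
    (hbs : ∀ b ∈ bs, NotNonposInt b) (hs : 0 < (bs.sum - as.sum).re) :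
    Summable (hypergeometricTerm as bs 1) := by
  simpa only [funext (hypergeometricTerm_one_eq hbs)] using
    (summable_regularizedTerm hlen hs).mul_left (bs.map Complex.Gamma).prod

theorem hypergeometricF_one_eq {as bs : List ℂ} (hbs : ∀ b ∈ bs, NotNonposInt b) :
    hypergeometricF as bs 1 =
      (bs.map Complex.Gamma).prod * ∑' k, regularizedTerm as bs k := by
  rw [hypergeometricF, funext (hypergeometricTerm_one_eq hbs), tsum_mul_left]

/-! ### Creative telescoping -/

theorem hasSum_eq_of_telescoping {f g E : ℕ → ℂ} {s t : ℂ} (hf : HasSum f s) (hg : HasSum g t)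
    (hE : Tendsto E atTop (𝓝 0)) (hzero : f 0 = E 0)
    (hsucc : ∀ k, f (k + 1) = g k + (E (k + 1) - E k)) : s = t := by
  have hpartial (n : ℕ) :
      ∑ k ∈ Finset.range (n + 1), f k = ∑ k ∈ Finset.range n, g k + E n := by
    induction n with
    | zero => simpa using hzero
    | succ n ih =>
      rw [Finset.sum_range_succ, ih, hsucc, Finset.sum_range_succ]
      ring
  have hlim := hg.tendsto_sum_nat.add hE
  rw [add_zero] at hlim
  exact tendsto_nhds_unique ((tendsto_add_atTop_iff_nat 1).2 hf.tendsto_sum_nat)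
    (hlim.congr fun n => (hpartial n).symm)

/-! ### Contiguous relations -/

theorem mul_regularizedTerm_add_one_cons (a : ℂ) (as bs : List ℂ) (k : ℕ) :
    a * regularizedTerm ((a + 1) :: as) bs k = (a + k) * regularizedTerm (a :: as) bs k := by
  simp only [regularizedTerm, List.map_cons, List.prod_cons]
  linear_combination (as.map fun a => poch a k).prod *
    (bs.map fun b => (Complex.Gamma (b + k))⁻¹).prod * (k.factorial : ℂ)⁻¹ * poch_add_one_mul a k

theorem mul_mul_regularizedTerm_add_one_cons_cons (a b : ℂ) (as bs : List ℂ) (k : ℕ) :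
    a * b * regularizedTerm ((a + 1) :: (b + 1) :: as) bs k =
      (a + k) * (b + k) * regularizedTerm (a :: b :: as) bs k := by
  simp only [regularizedTerm, List.map_cons, List.prod_cons]
  linear_combination (as.map fun a => poch a k).prod *
    (bs.map fun b => (Complex.Gamma (b + k))⁻¹).prod * (k.factorial : ℂ)⁻¹ *
    (b * poch (b + 1) k * poch_add_one_mul a k + (a + k) * poch a k * poch_add_one_mul b k)

/-- The regularized `₃F₂` of the transformation, for `a = 2y`, `b = h - x + y` and `c = x + y`. In
these coordinates both sides satisfy recurrences under the shift `h ↦ h + 1`. -/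
noncomputable def threeTerm (h x y : ℂ) : ℕ → ℂ :=
  regularizedTerm [2 * y, h - x + y, x + y] [2 * h - x + y, h + x + y]

/-- The contiguous series which closes `threeTerm` up to a pair of first-order recurrences under
`h ↦ h + 1`. -/
noncomputable def threeTermCompanion (h x y : ℂ) : ℕ → ℂ :=
  regularizedTerm [2 * y + 1, x + y, h - x + y + 1] [2 * h - x + y + 2, h + x + y + 1]

/-- The regularized `₅F₄` of the transformation, in the coordinates of `threeTerm`. -/
noncomputable def fiveTerm (h x y : ℂ) : ℕ → ℂ :=
  regularizedTerm [2 * h - 1, x, h - y, y, h - x] [2 * h - x, h + y, 2 * h - y, h + x]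

/-- The contiguous series which plays for `fiveTerm` the role of `threeTermCompanion`. -/
noncomputable def fiveTermCompanion (h x y : ℂ) : ℕ → ℂ :=
  regularizedTerm [2 * h + 1, y + 1, x, h - x + 1, h - y + 1]
    [2 * h - x + 2, h + x + 1, 2 * h - y + 1, h + y + 1]

section Telescoping

variable (h x y : ℂ) (k : ℕ)

theorem threeTerm_add_one : threeTerm (h + 1) x y =
    regularizedTerm [2 * y, h - x + y + 1, x + y] [2 * h - x + y + 2, h + x + y + 1] := by
  unfold threeTerm
  ring_nf

theorem threeTermCompanion_add_one : threeTermCompanion (h + 1) x y =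
    regularizedTerm [2 * y + 1, x + y, h - x + y + 1 + 1]
      [2 * h - x + y + 2 + 1 + 1, h + x + y + 1 + 1] := by
  unfold threeTermCompanion
  ring_nf

theorem fiveTerm_add_one : fiveTerm (h + 1) x y =
    regularizedTerm [2 * h + 1, x, h - y + 1, y, h - x + 1]
      [2 * h - x + 2, h + y + 1, 2 * h - y + 1 + 1, h + x + 1] := by
  unfold fiveTerm
  ring_nf

theorem fiveTermCompanion_add_one : fiveTermCompanion (h + 1) x y =
    regularizedTerm [2 * h + 2 + 1, y + 1, x, h - x + 1 + 1, h - y + 1 + 1]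
      [2 * h - x + 2 + 1 + 1, h + x + 1 + 1, 2 * h - y + 1 + 1 + 1, h + y + 1 + 1] := by
  unfold fiveTermCompanion
  ring_nf

theorem threeTerm_telescoping :
    (h - y) * threeTerm h x y (k + 1) =
      h * (2 * h - x) * (h + x - y) * (2 * h - x - y + 1) * threeTerm (h + 1) x y k +
      h * y * (10 * h ^ 2 - 6 * h * (x + y) + 4 * x * y + 3 * h - x - y) *
        threeTermCompanion h x y k +
      (((h - y) * (2 * h - x + y) - (h - x + y) / 2 * (k + 1)) *
          regularizedTerm [2 * y, h - x + y + 1, x + y] [2 * h - x + y + 1, h + x + y] (k + 1) -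
        ((h - y) * (2 * h - x + y) - (h - x + y) / 2 * k) *
          regularizedTerm [2 * y, h - x + y + 1, x + y] [2 * h - x + y + 1, h + x + y] k) := by
  have hcompanion := mul_regularizedTerm_add_one_cons (2 * y) [x + y, h - x + y + 1]
    [2 * h - x + y + 2, h + x + y + 1] k
  rw [threeTerm_add_one]
  have htwo : 2 * h - x + y + 1 + 1 = 2 * h - x + y + 2 := by ring
  simp only [threeTerm, threeTermCompanion, regularizedTerm, List.map_cons, List.map_nil,
    List.prod_cons, List.prod_nil, poch_succ (2 * y) k, poch_succ (x + y) k,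
    poch_succ_left (h - x + y) k, poch_succ (h - x + y + 1) k,
    inv_factorial_eq_add_one_mul k, add_natCast_succ, htwo,
    inv_Gamma_add_natCast_eq_add_one (2 * h - x + y + 1) k,
    inv_Gamma_add_natCast_eq_add_one (h + x + y) k] at hcompanion ⊢
  linear_combination
    -(h / 2 * (10 * h ^ 2 - 6 * h * (x + y) + 4 * x * y + 3 * h - x - y)) * hcompanion

theorem threeTermCompanion_telescoping :
    (2 * h - 2 * y + 1) * (2 * h - x + 2) * threeTermCompanion h x y (k + 1) -
        (5 * h ^ 2 + 8 * h + 3 - 3 * h * x - 3 * h * y - 2 * x - 3 * y + 2 * x * y) *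
          threeTerm (h + 1) x y (k + 1) =
      -((h + 1) * (2 * h - 2 * x + 3) * (h - x + 1) * (2 * h - x - y + 2) * (h - x + y + 1) *
        threeTermCompanion (h + 1) x y k) +
      (-((h - x + y + 1) * ((h + 1) * (2 * h - x + y + 2) + (2 * h - x + 2) * (k + 1)) *
          regularizedTerm [2 * y + 1, h - x + y + 2, x + y]
            [2 * h - x + y + 3, h + x + y + 1] (k + 1)) -
        -((h - x + y + 1) * ((h + 1) * (2 * h - x + y + 2) + (2 * h - x + 2) * k) *
          regularizedTerm [2 * y + 1, h - x + y + 2, x + y]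
            [2 * h - x + y + 3, h + x + y + 1] k)) := by
  have htwo : h - x + y + 1 + 1 = h - x + y + 2 := by ring
  have hthree : 2 * h - x + y + 2 + 1 = 2 * h - x + y + 3 := by ring
  rw [threeTerm_add_one, threeTermCompanion_add_one]
  simp only [threeTermCompanion, regularizedTerm, List.map_cons, List.map_nil,
    List.prod_cons, List.prod_nil, poch_succ_left (2 * y) k, poch_succ (2 * y + 1) k,
    poch_succ (x + y) k, poch_succ_left (h - x + y + 1) k, poch_succ (h - x + y + 2) k,
    inv_factorial_eq_add_one_mul k, add_natCast_succ, htwo, hthree,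
    inv_Gamma_add_natCast_eq_add_one (2 * h - x + y + 3) k,
    inv_Gamma_add_natCast_eq_add_one (h + x + y + 1) k]
  ring

theorem fiveTerm_telescoping :
    fiveTerm h x y (k + 1) =
      2 * h ^ 2 * (2 * h - x) * (2 * h - 2 * y + 1) * (h + x - y) * (2 * h - x - y + 1) *
        fiveTerm (h + 1) x y k +
      2 * h ^ 2 * y * (10 * h ^ 2 - 6 * h * (x + y) + 4 * x * y + 3 * h - x - y) *
        fiveTermCompanion h x y k +
      (2 * h - x) * (2 * h - y) *
        (regularizedTerm [2 * h, x, h - x + 1, y, h - y + 1]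
          [2 * h - x + 1, h + x, 2 * h - y + 1, h + y] (k + 1) -
        regularizedTerm [2 * h, x, h - x + 1, y, h - y + 1]
          [2 * h - x + 1, h + x, 2 * h - y + 1, h + y] k) := by
  have hfive := mul_regularizedTerm_add_one_cons (2 * h) [x, h - x + 1, y, h - y + 1]
    [2 * h - x + 2, h + x + 1, 2 * h - y + 1 + 1, h + y + 1] k
  have hcompanion := mul_mul_regularizedTerm_add_one_cons_cons (2 * h) y
    [x, h - x + 1, h - y + 1] [2 * h - x + 2, h + x + 1, 2 * h - y + 1, h + y + 1] k
  have htwo : 2 * h - x + 1 + 1 = 2 * h - x + 2 := by ring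
  rw [fiveTerm_add_one]
  simp only [fiveTerm, fiveTermCompanion, regularizedTerm, List.map_cons, List.map_nil,
    List.prod_cons, List.prod_nil, poch_succ (2 * h) k, poch_succ x k, poch_succ y k,
    poch_succ_left (2 * h - 1) k, poch_succ_left (h - x) k, poch_succ_left (h - y) k,
    poch_succ (h - x + 1) k, poch_succ (h - y + 1) k, inv_factorial_eq_add_one_mul k,
    sub_add_cancel, inv_Gamma_add_natCast_eq_add_one (2 * h - x + 1) k,
    inv_Gamma_add_natCast_eq_add_one (h + x) k, inv_Gamma_add_natCast_eq_add_one (h + y) k,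
    inv_Gamma_add_natCast_eq_add_one (2 * h - y + 1) k, add_natCast_succ, htwo]
    at hfive hcompanion ⊢
  linear_combination
    -(h * (2 * h - x) * (2 * h - 2 * y + 1) * (h + x - y) * (2 * h - x - y + 1)) * hfive -
      h * (10 * h ^ 2 - 6 * h * (x + y) + 4 * x * y + 3 * h - x - y) * hcompanion

theorem fiveTermCompanion_telescoping :
    (2 * h - x + 2) * fiveTermCompanion h x y (k + 1) -
        (5 * h ^ 2 + 8 * h + 3 - 3 * h * x - 3 * h * y - 2 * x - 3 * y + 2 * x * y) *
          fiveTerm (h + 1) x y (k + 1) =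
      -(2 * (h + 1) ^ 2 * (2 * h - 2 * x + 3) * (h - x + y + 1) * (2 * h - x - y + 2) *
        (h - x + 1) * (h - y + 1) * fiveTermCompanion (h + 1) x y k) +
      -((2 * h - x + 2) * (h - x + 1) * (h - y + 1)) *
        (regularizedTerm [2 * h + 2, x, h - x + 2, y + 1, h - y + 2]
          [2 * h - x + 3, h + x + 1, 2 * h - y + 2, h + y + 1] (k + 1) -
        regularizedTerm [2 * h + 2, x, h - x + 2, y + 1, h - y + 2]
          [2 * h - x + 3, h + x + 1, 2 * h - y + 2, h + y + 1] k) := by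
  have hcompanion := mul_regularizedTerm_add_one_cons (2 * h + 2)
    [y + 1, x, h - x + 2, h - y + 2]
    [2 * h - x + 3 + 1, h + x + 1 + 1, 2 * h - y + 2 + 1, h + y + 1 + 1] k
  have htwo_h : 2 * h + 1 + 1 = 2 * h + 2 := by ring
  have htwo_x : h - x + 1 + 1 = h - x + 2 := by ring
  have htwo_y : h - y + 1 + 1 = h - y + 2 := by ring
  have hthree_x : 2 * h - x + 2 + 1 = 2 * h - x + 3 := by ring
  have htwo_y' : 2 * h - y + 1 + 1 = 2 * h - y + 2 := by ring
  rw [fiveTerm_add_one, fiveTermCompanion_add_one]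
  simp only [fiveTermCompanion, regularizedTerm, List.map_cons, List.map_nil,
    List.prod_cons, List.prod_nil, poch_succ_left (2 * h + 1) k, poch_succ (2 * h + 2) k,
    poch_succ x k, poch_succ (y + 1) k, poch_succ_left y k,
    poch_succ_left (h - x + 1) k, poch_succ_left (h - y + 1) k,
    poch_succ (h - x + 2) k, poch_succ (h - y + 2) k, inv_factorial_eq_add_one_mul k,
    inv_Gamma_add_natCast_eq_add_one (2 * h - x + 3) k,
    inv_Gamma_add_natCast_eq_add_one (h + x + 1) k,
    inv_Gamma_add_natCast_eq_add_one (h + y + 1) k,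
    inv_Gamma_add_natCast_eq_add_one (2 * h - y + 2) k, add_natCast_succ,
    htwo_h, htwo_x, htwo_y, hthree_x, htwo_y'] at hcompanion ⊢
  linear_combination
    (h + 1) * (2 * h - 2 * x + 3) * (h - x + y + 1) * (2 * h - x - y + 2) *
        (h - x + 1) * (h - y + 1) * hcompanion

end Telescoping

section Relations

variable {h x y : ℂ}

theorem summable_threeTerm (hre : y.re < h.re) : Summable (threeTerm h x y) := by
  refine summable_regularizedTerm rfl ?_
  simp only [List.sum_cons, List.sum_nil, Complex.sub_re, Complex.add_re, Complex.mul_re,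
    Complex.re_ofNat, Complex.im_ofNat, Complex.zero_re]
  linarith

theorem summable_threeTermCompanion (hre : y.re < h.re) :
    Summable (threeTermCompanion h x y) := by
  refine summable_regularizedTerm rfl ?_
  simp only [List.sum_cons, List.sum_nil, Complex.sub_re, Complex.add_re, Complex.mul_re,
    Complex.re_ofNat, Complex.im_ofNat, Complex.one_re, Complex.zero_re]
  linarith

theorem summable_fiveTerm (hre : -1 < 2 * h.re) : Summable (fiveTerm h x y) := by
  refine summable_regularizedTerm rfl ?_
  simp only [List.sum_cons, List.sum_nil, Complex.sub_re, Complex.add_re, Complex.mul_re,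
    Complex.re_ofNat, Complex.im_ofNat, Complex.one_re, Complex.zero_re]
  linarith

theorem summable_fiveTermCompanion (hre : -1 < 2 * h.re) :
    Summable (fiveTermCompanion h x y) := by
  refine summable_regularizedTerm rfl ?_
  simp only [List.sum_cons, List.sum_nil, Complex.sub_re, Complex.add_re, Complex.mul_re,
    Complex.re_ofNat, Complex.im_ofNat, Complex.one_re, Complex.zero_re]
  linarith

theorem tsum_threeTerm_relation (hre : y.re < h.re) :
    (h - y) * ∑' k, threeTerm h x y k =
      h * (2 * h - x) * (h + x - y) * (2 * h - x - y + 1) * ∑' k, threeTerm (h + 1) x y k +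
      h * y * (10 * h ^ 2 - 6 * h * (x + y) + 4 * x * y + 3 * h - x - y) *
        ∑' k, threeTermCompanion h x y k := by
  have hre' : y.re < (h + 1).re := by
    rw [Complex.add_re, Complex.one_re]
    linarith
  have hcert := tendsto_linear_mul_regularizedTerm (as := [2 * y, h - x + y + 1, x + y])
    (bs := [2 * h - x + y + 1, h + x + y]) rfl (by
      simp only [List.sum_cons, List.sum_nil, Complex.sub_re, Complex.add_re, Complex.mul_re,
        Complex.re_ofNat, Complex.im_ofNat, Complex.one_re, Complex.zero_re]
      linarith) ((h - y) * (2 * h - x + y)) (-((h - x + y) / 2))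
  refine hasSum_eq_of_telescoping ((summable_threeTerm hre).hasSum.mul_left _)
    (((summable_threeTerm (x := x) hre').hasSum.mul_left _).add
      ((summable_threeTermCompanion (x := x) hre).hasSum.mul_left _)) hcert ?_ fun k => ?_
  · simp only [threeTerm, regularizedTerm_zero, List.map_cons, List.map_nil, List.prod_cons,
      List.prod_nil, Complex.one_div_Gamma_eq_self_mul_one_div_Gamma_add_one (2 * h - x + y)]
    push_cast
    ring
  · push_cast
    linear_combination threeTerm_telescoping h x y k

theorem tsum_threeTermCompanion_relation (hre : y.re < h.re) :
    (2 * h - 2 * y + 1) * (2 * h - x + 2) * ∑' k, threeTermCompanion h x y k =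
      (5 * h ^ 2 + 8 * h + 3 - 3 * h * x - 3 * h * y - 2 * x - 3 * y + 2 * x * y) *
          ∑' k, threeTerm (h + 1) x y k -
      (h + 1) * (2 * h - 2 * x + 3) * (h - x + 1) * (2 * h - x - y + 2) * (h - x + y + 1) *
        ∑' k, threeTermCompanion (h + 1) x y k := by
  have hre' : y.re < (h + 1).re := by
    rw [Complex.add_re, Complex.one_re]
    linarith
  have hcert := tendsto_linear_mul_regularizedTerm (as := [2 * y + 1, h - x + y + 2, x + y])
    (bs := [2 * h - x + y + 3, h + x + y + 1]) rfl (by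
      simp only [List.sum_cons, List.sum_nil, Complex.sub_re, Complex.add_re, Complex.mul_re,
        Complex.re_ofNat, Complex.im_ofNat, Complex.one_re, Complex.zero_re]
      linarith) (-((h - x + y + 1) * ((h + 1) * (2 * h - x + y + 2))))
      (-((h - x + y + 1) * (2 * h - x + 2)))
  have hrel := hasSum_eq_of_telescoping
    (((summable_threeTermCompanion (x := x) hre).hasSum.mul_left
      ((2 * h - 2 * y + 1) * (2 * h - x + 2))).sub
        ((summable_threeTerm (x := x) hre').hasSum.mul_left
        (5 * h ^ 2 + 8 * h + 3 - 3 * h * x - 3 * h * y - 2 * x - 3 * y + 2 * x * y)))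
    ((summable_threeTermCompanion (x := x) hre').hasSum.mul_left (-((h + 1) * (2 * h - 2 * x + 3) *
      (h - x + 1) * (2 * h - x - y + 2) * (h - x + y + 1)))) hcert ?_ fun k => ?_
  · linear_combination hrel
  · simp only [threeTermCompanion, threeTerm_add_one, regularizedTerm_zero, List.map_cons,
      List.map_nil, List.prod_cons, List.prod_nil,
      Complex.one_div_Gamma_eq_self_mul_one_div_Gamma_add_one (2 * h - x + y + 2),
      show 2 * h - x + y + 2 + 1 = 2 * h - x + y + 3 by ring]
    push_cast
    ring
  · push_cast
    linear_combination threeTermCompanion_telescoping h x y k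

theorem tsum_fiveTerm_relation (hre : -1 < 2 * h.re) :
    ∑' k, fiveTerm h x y k =
      2 * h ^ 2 * (2 * h - x) * (2 * h - 2 * y + 1) * (h + x - y) * (2 * h - x - y + 1) *
        ∑' k, fiveTerm (h + 1) x y k +
      2 * h ^ 2 * y * (10 * h ^ 2 - 6 * h * (x + y) + 4 * x * y + 3 * h - x - y) *
        ∑' k, fiveTermCompanion h x y k := by
  have hre' : -1 < 2 * (h + 1).re := by
    rw [Complex.add_re, Complex.one_re]
    linarith
  have hcert := (tendsto_regularizedTerm
    (as := [2 * h, x, h - x + 1, y, h - y + 1])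
    (bs := [2 * h - x + 1, h + x, 2 * h - y + 1, h + y]) rfl (by
      simp only [List.sum_cons, List.sum_nil, Complex.sub_re, Complex.add_re, Complex.mul_re,
        Complex.re_ofNat, Complex.im_ofNat, Complex.one_re, Complex.zero_re]
      linarith)).const_mul ((2 * h - x) * (2 * h - y))
  rw [mul_zero] at hcert
  refine hasSum_eq_of_telescoping (summable_fiveTerm hre).hasSum
    (((summable_fiveTerm (x := x) (y := y) hre').hasSum.mul_left _).add
      ((summable_fiveTermCompanion (x := x) (y := y) hre).hasSum.mul_left _)) hcert ?_ fun k => ?_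
  · simp only [fiveTerm, regularizedTerm_zero, List.map_cons, List.map_nil, List.prod_cons,
      List.prod_nil, Complex.one_div_Gamma_eq_self_mul_one_div_Gamma_add_one (2 * h - x),
      Complex.one_div_Gamma_eq_self_mul_one_div_Gamma_add_one (2 * h - y)]
    ring
  · linear_combination fiveTerm_telescoping h x y k

theorem tsum_fiveTermCompanion_relation (hre : -1 < 2 * h.re) :
    (2 * h - x + 2) * ∑' k, fiveTermCompanion h x y k =
      (5 * h ^ 2 + 8 * h + 3 - 3 * h * x - 3 * h * y - 2 * x - 3 * y + 2 * x * y) *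
          ∑' k, fiveTerm (h + 1) x y k -
      2 * (h + 1) ^ 2 * (2 * h - 2 * x + 3) * (h - x + y + 1) * (2 * h - x - y + 2) *
        (h - x + 1) * (h - y + 1) * ∑' k, fiveTermCompanion (h + 1) x y k := by
  have hre' : -1 < 2 * (h + 1).re := by
    rw [Complex.add_re, Complex.one_re]
    linarith
  have hcert := (tendsto_regularizedTerm
    (as := [2 * h + 2, x, h - x + 2, y + 1, h - y + 2])
    (bs := [2 * h - x + 3, h + x + 1, 2 * h - y + 2, h + y + 1]) rfl (by
      simp only [List.sum_cons, List.sum_nil, Complex.sub_re, Complex.add_re, Complex.mul_re,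
        Complex.re_ofNat, Complex.im_ofNat, Complex.one_re, Complex.zero_re]
      linarith)).const_mul (-((2 * h - x + 2) * (h - x + 1) * (h - y + 1)))
  rw [mul_zero] at hcert
  have hrel := hasSum_eq_of_telescoping
    (((summable_fiveTermCompanion (x := x) (y := y) hre).hasSum.mul_left (2 * h - x + 2)).sub
      ((summable_fiveTerm (x := x) (y := y) hre').hasSum.mul_left
        (5 * h ^ 2 + 8 * h + 3 - 3 * h * x - 3 * h * y - 2 * x - 3 * y + 2 * x * y)))
    ((summable_fiveTermCompanion (x := x) (y := y) hre').hasSum.mul_left (-(2 * (h + 1) ^ 2 *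
      (2 * h - 2 * x + 3) * (h - x + y + 1) * (2 * h - x - y + 2) * (h - x + 1) * (h - y + 1))))
    hcert ?_ fun k => ?_
  · linear_combination hrel
  · simp only [fiveTermCompanion, fiveTerm_add_one, regularizedTerm_zero, List.map_cons,
      List.map_nil, List.prod_cons, List.prod_nil,
      Complex.one_div_Gamma_eq_self_mul_one_div_Gamma_add_one (2 * h - x + 2),
      Complex.one_div_Gamma_eq_self_mul_one_div_Gamma_add_one (2 * h - y + 1),
      show 2 * h - x + 2 + 1 = 2 * h - x + 3 by ring,
      show 2 * h - y + 1 + 1 = 2 * h - y + 2 by ring]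
    ring
  · linear_combination fiveTermCompanion_telescoping h x y k

end Relations

/-! ### Series whose lower parameters tend to infinity -/

theorem norm_succ_le_of_ratio_le {t : ℕ → ℂ} {K S : ℝ} (hzero : t 0 = 1) (hK : 0 ≤ K)
    (hS : (K + 1) * (2 * K + 1) ≤ S)
    (hratio : ∀ k : ℕ, ‖t (k + 1)‖ * ((S + k) * (k + 1)) ≤ ‖t k‖ * (K + k) ^ 2) (k : ℕ) :
    ‖t (k + 1)‖ ≤ 4 * K ^ 2 / S * (1 / ((k : ℝ) + 2) ^ 2) := by
  have hSpos : 0 < S := by nlinarith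
  induction k with
  | zero =>
    have h := hratio 0
    simp only [Nat.cast_zero, add_zero, zero_add, mul_one, hzero, norm_one, one_mul] at h
    calc ‖t (0 + 1)‖ ≤ K ^ 2 / S := (le_div_iff₀ hSpos).2 h
      _ = 4 * K ^ 2 / S * (1 / (((0 : ℕ) : ℝ) + 2) ^ 2) := by push_cast; ring
  | succ k ih =>
    have h := (hratio (k + 1)).trans (mul_le_mul_of_nonneg_right ih (by positivity))
    have hpoly : (K + (k + 1 : ℕ)) ^ 2 * ((k : ℝ) + 3) ^ 2 ≤
        (k + 2) ^ 2 * ((S + (k + 1 : ℕ)) * ((k + 1 : ℕ) + 1)) := by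
      have hsqrt : (K + (k + 1)) * ((k : ℝ) + 3) ≤ (k + 2) * (k + 2 + 3 / 2 * K) := by
        nlinarith [mul_nonneg hK k.cast_nonneg (α := ℝ)]
      have hsq := pow_le_pow_left₀ (by positivity) hsqrt 2
      push_cast
      have : (k + 2 + 3 / 2 * K) ^ 2 ≤ ((k : ℝ) + 2) * (S + (k + 1)) := by
        nlinarith [mul_nonneg hK hK, mul_nonneg (mul_nonneg hK hK) k.cast_nonneg (α := ℝ),
          mul_le_mul_of_nonneg_left hS (show (0 : ℝ) ≤ k + 2 by positivity)]
      nlinarith [mul_le_mul_of_nonneg_left this (show (0 : ℝ) ≤ (k + 2) ^ 2 by positivity)]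
    rw [← le_div_iff₀ (by positivity)] at h
    refine h.trans ?_
    rw [mul_assoc, mul_div_assoc]
    refine mul_le_mul_of_nonneg_left ?_ (by positivity)
    rw [div_le_div_iff₀ (by positivity) (by positivity)]
    push_cast at hpoly ⊢
    field_simp
    nlinarith [hpoly]

theorem norm_tsum_sub_one_le_of_ratio_le {t : ℕ → ℂ} {K S : ℝ} (hzero : t 0 = 1) (hK : 0 ≤ K)
    (hS : (K + 1) * (2 * K + 1) ≤ S)
    (hratio : ∀ k : ℕ, ‖t (k + 1)‖ * ((S + k) * (k + 1)) ≤ ‖t k‖ * (K + k) ^ 2) :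
    ‖∑' k, t k - 1‖ ≤ 4 * K ^ 2 / S * ∑' k : ℕ, 1 / ((k : ℝ) + 2) ^ 2 := by
  have hmajorant : Summable fun k : ℕ => 1 / ((k : ℝ) + 2) ^ 2 := by
    exact_mod_cast (summable_nat_add_iff 2).2 (Real.summable_one_div_nat_pow.2 one_lt_two)
  have hbound := norm_succ_le_of_ratio_le hzero hK hS hratio
  have hsummable : Summable t := (summable_nat_add_iff 1).1
    (Summable.of_norm_bounded (hmajorant.mul_left _) hbound)
  rw [hsummable.tsum_eq_zero_add, hzero, add_sub_cancel_left]
  exact tsum_of_norm_bounded (hmajorant.hasSum.mul_left _) hbound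

theorem hypergeometricTerm_one_zero (as bs : List ℂ) : hypergeometricTerm as bs 1 0 = 1 := by
  simp [hypergeometricTerm]

theorem hypergeometricTerm_one_succ (as bs : List ℂ) (k : ℕ) :
    hypergeometricTerm as bs 1 (k + 1) = hypergeometricTerm as bs 1 k *
      ((as.map (· + (k : ℂ))).prod / ((bs.map (· + (k : ℂ))).prod * (k + 1))) := by
  simp only [hypergeometricTerm, ascPochhammer_succ_eval, List.prod_map_mul, one_pow, mul_one,
    Nat.factorial_succ, Nat.cast_mul, Nat.cast_succ]
  rw [div_mul_div_comm]
  congr 1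
  ring

theorem add_natCast_re_le_norm (a : ℂ) (k : ℕ) : a.re + k ≤ ‖a + k‖ := by
  simpa using Complex.re_le_norm (a + k)

theorem norm_prod_add_mul_le (l : List (ℂ × ℂ)) {K σ : ℝ} (hσ : l.length * K ≤ σ)
    (hK : ∀ p ∈ l, ‖p.2‖ ≤ K) (hre : ∀ p ∈ l, σ ≤ p.1.re) (k : ℕ) :
    ‖(l.map fun p : ℂ × ℂ => p.1 + p.2 + (k : ℂ)).prod‖ * (σ - l.length * K + k) ≤
      ‖(l.map fun p : ℂ × ℂ => p.1 + (k : ℂ)).prod‖ * (σ + k) := by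
  induction l with
  | nil => simp
  | cons p l ih =>
    have hKp := hK p List.mem_cons_self
    have hσp := hre p List.mem_cons_self
    rw [List.length_cons, Nat.cast_succ] at hσ ⊢
    have ih := ih (by linarith [norm_nonneg p.2]) (fun q hq => hK q (List.mem_cons_of_mem p hq))
      fun q hq => hre q (List.mem_cons_of_mem p hq)
    have hupper : ‖p.1 + p.2 + (k : ℂ)‖ ≤ ‖p.1 + (k : ℂ)‖ + K := by
      rw [add_right_comm]
      exact (norm_add_le _ _).trans (by linarith)
    have hlower := add_natCast_re_le_norm p.1 k
    have hfactor : ‖p.1 + p.2 + (k : ℂ)‖ * (σ - (l.length + 1) * K + k) ≤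
        ‖p.1 + (k : ℂ)‖ * (σ - l.length * K + k) := by
      have hnonneg : 0 ≤ σ - (l.length + 1) * K + k := by
        linarith [k.cast_nonneg (α := ℝ)]
      have hKnonneg : 0 ≤ K := (norm_nonneg _).trans hKp
      have hle : σ - (l.length + 1) * K + k ≤ ‖p.1 + (k : ℂ)‖ := by
        have : 0 ≤ ((l.length : ℝ) + 1) * K := by positivity
        linarith
      nlinarith [mul_le_mul_of_nonneg_right hupper hnonneg,
        mul_le_mul_of_nonneg_left hle hKnonneg]
    simp only [List.map_cons, List.prod_cons, norm_mul]
    nlinarith [mul_le_mul_of_nonneg_right hfactor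
      (norm_nonneg (l.map fun p : ℂ × ℂ => p.1 + p.2 + (k : ℂ)).prod),
      mul_le_mul_of_nonneg_left ih (norm_nonneg (p.1 + (k : ℂ)))]

theorem norm_hypergeometricTerm_one_succ_mul_le (l : List (ℂ × ℂ)) {α β B : ℂ} {K σ : ℝ}
    (hα : ‖α‖ ≤ K) (hβ : ‖β‖ ≤ K) (hσ : l.length * K < σ) (hB : σ ≤ B.re)
    (hK : ∀ p ∈ l, ‖p.2‖ ≤ K) (hre : ∀ p ∈ l, σ ≤ p.1.re) (k : ℕ) :
    ‖hypergeometricTerm (α :: β :: l.map fun p => p.1 + p.2) (B :: l.map Prod.fst) 1 (k + 1)‖ *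
        ((σ - l.length * K + k) * (k + 1)) ≤
      ‖hypergeometricTerm (α :: β :: l.map fun p => p.1 + p.2) (B :: l.map Prod.fst) 1 k‖ *
        (K + k) ^ 2 := by
  have hKnonneg : 0 ≤ K := (norm_nonneg _).trans hα
  have hσpos : 0 < σ := lt_of_le_of_lt (by positivity) hσ
  have hlist := norm_prod_add_mul_le l hσ.le hK hre k
  set P := (l.map fun p : ℂ × ℂ => p.1 + p.2 + (k : ℂ)).prod with hP
  set Q := (l.map fun p : ℂ × ℂ => p.1 + (k : ℂ)).prod with hQ
  have hpos (b : ℂ) (hb : σ ≤ b.re) : 0 < ‖b + k‖ := by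
    linarith [add_natCast_re_le_norm b k, k.cast_nonneg (α := ℝ)]
  have hQpos : 0 < ‖Q‖ := by
    refine norm_pos_iff.2 (List.prod_ne_zero fun hzero => ?_)
    obtain ⟨p, hp, hp₀⟩ := List.mem_map.1 hzero
    exact (hpos p.1 (hre p hp)).ne' (norm_eq_zero.2 hp₀)
  have hBpos := hpos B hB
  have hBk : σ + k ≤ ‖B + k‖ := by linarith [add_natCast_re_le_norm B k]
  have hnorm (a : ℂ) (ha : ‖a‖ ≤ K) : ‖a + k‖ ≤ K + k := by
    simpa using norm_add_le_of_le ha (Complex.norm_natCast k).le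
  have hupper : ‖α + k‖ * ‖β + k‖ ≤ (K + k) * (K + k) :=
    mul_le_mul (hnorm α hα) (hnorm β hβ) (norm_nonneg _) (by positivity)
  have hlower : ‖P‖ * (σ - l.length * K + k) ≤ ‖Q‖ * ‖B + k‖ :=
    hlist.trans (mul_le_mul_of_nonneg_left hBk (norm_nonneg _))
  have hnonneg : 0 ≤ ‖P‖ * (σ - l.length * K + k) :=
    mul_nonneg (norm_nonneg _) (by linarith [k.cast_nonneg (α := ℝ)])
  have hk : ‖(k : ℂ) + 1‖ = k + 1 := by exact_mod_cast Complex.norm_natCast (k + 1)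
  rw [hypergeometricTerm_one_succ, norm_mul, mul_assoc]
  refine mul_le_mul_of_nonneg_left ?_ (norm_nonneg _)
  simp only [List.map_cons, List.prod_cons, List.map_map, Function.comp_def, ← hP, ← hQ, norm_div,
    norm_mul, hk]
  rw [div_mul_eq_mul_div, div_le_iff₀ (by positivity)]
  calc ‖α + k‖ * (‖β + k‖ * ‖P‖) * ((σ - l.length * K + k) * (k + 1))
      = ‖α + k‖ * ‖β + k‖ * (‖P‖ * (σ - l.length * K + k)) * (k + 1) := by ring
    _ ≤ (K + k) * (K + k) * (‖Q‖ * ‖B + k‖) * (k + 1) :=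
        mul_le_mul_of_nonneg_right (mul_le_mul hupper hlower hnonneg (by positivity))
          (by positivity)
    _ = (K + k) ^ 2 * (‖B + k‖ * ‖Q‖ * (k + 1)) := by ring

theorem tendsto_tsum_hypergeometricTerm_one (α β : ℂ) {B : ℕ → ℂ} {l : List ((ℕ → ℂ) × ℂ)}
    (hB : Tendsto (fun N => (B N).re) atTop atTop)
    (hl : ∀ p ∈ l, Tendsto (fun N => (p.1 N).re) atTop atTop) :
    Tendsto (fun N => ∑' k, hypergeometricTerm (α :: β :: l.map fun p => p.1 N + p.2)
      (B N :: l.map fun p => p.1 N) 1 k) atTop (𝓝 1) := by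
  obtain ⟨K, hK⟩ :=
    (((List.finite_toSet l).image fun p => ‖p.2‖).insert ‖β‖ |>.insert ‖α‖).bddAbove
  simp only [upperBounds_insert, Set.mem_inter_iff, Set.mem_Ici, mem_upperBounds,
    Set.forall_mem_image] at hK
  obtain ⟨hα, hβ, hK⟩ := hK
  have hKnonneg : 0 ≤ K := (norm_nonneg _).trans hα
  set C : ℝ := ∑' k : ℕ, 1 / ((k : ℝ) + 2) ^ 2
  have hbound (σ : ℝ) (hσ : (K + 1) * (2 * K + 1) ≤ σ) : ∀ᶠ N in atTop,
      ‖∑' k, hypergeometricTerm (α :: β :: l.map fun p => p.1 N + p.2)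
        (B N :: l.map fun p => p.1 N) 1 k - 1‖ ≤ 4 * K ^ 2 / σ * C := by
    filter_upwards [hB.eventually_ge_atTop (σ + l.length * K),
      ((List.finite_toSet l).eventually_all (l := atTop)).2 fun p hp =>
        (hl p hp).eventually_ge_atTop (σ + l.length * K)] with N hBN hlN
    refine norm_tsum_sub_one_le_of_ratio_le (hypergeometricTerm_one_zero _ _) hKnonneg hσ
      fun k => ?_
    have h := norm_hypergeometricTerm_one_succ_mul_le (l.map fun p => (p.1 N, p.2))
      (σ := σ + l.length * K) hα hβ (by rw [List.length_map]; nlinarith) hBN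
      (List.forall_mem_map.2 fun p hp => hK hp) (List.forall_mem_map.2 hlN) k
    simpa [Function.comp_def] using h
  have hlim : Tendsto (fun σ : ℝ => 4 * K ^ 2 / σ * C) atTop (𝓝 0) := by
    simpa using (tendsto_id.const_div_atTop (4 * K ^ 2)).mul_const C
  refine Metric.tendsto_nhds.2 fun ε hε => ?_
  obtain ⟨σ, hσε, hσ⟩ :=
    ((hlim.eventually_lt_const hε).and (eventually_ge_atTop ((K + 1) * (2 * K + 1)))).exists
  filter_upwards [hbound σ hσ] with N hN
  rw [dist_eq_norm]
  exact hN.trans_lt hσε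

theorem tendsto_tsum_regularizedTerm (α β : ℂ) {B : ℕ → ℂ} {l : List ((ℕ → ℂ) × ℂ)}
    (hB : Tendsto (fun N => (B N).re) atTop atTop)
    (hl : ∀ p ∈ l, Tendsto (fun N => (p.1 N).re) atTop atTop) :
    Tendsto (fun N => Complex.Gamma (B N) * (l.map fun p => Complex.Gamma (p.1 N)).prod *
      ∑' k, regularizedTerm (α :: β :: l.map fun p => p.1 N + p.2)
        (B N :: l.map fun p => p.1 N) k) atTop (𝓝 1) := by
  refine (tendsto_tsum_hypergeometricTerm_one α β hB hl).congr' ?_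
  filter_upwards [hB.eventually_gt_atTop 0,
    ((List.finite_toSet l).eventually_all (l := atTop)).2 fun p hp =>
      (hl p hp).eventually_gt_atTop 0] with N hBN hlN
  have hlower : ∀ b ∈ B N :: l.map fun p => p.1 N, NotNonposInt b :=
    List.forall_mem_cons.2 ⟨.of_re_pos hBN,
      List.forall_mem_map.2 fun p hp => .of_re_pos (hlN p hp)⟩
  rw [← hypergeometricF, hypergeometricF_one_eq hlower]
  simp only [List.map_cons, List.prod_cons, List.map_map, Function.comp_def]

/-! ### Asymptotics along integer shifts -/

theorem tendsto_mul_add_natCast_add_div (h c d : ℂ) :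
    Tendsto (fun N : ℕ => (c * (h + N) + d) / N) atTop (𝓝 c) := by
  have hlim := (tendsto_const_div_atTop_nhds_zero_nat (c * h + d)).const_add c
  rw [add_zero] at hlim
  refine hlim.congr' ?_
  filter_upwards [eventually_ne_atTop 0] with N hN
  rw [mul_add, add_right_comm, add_comm _ (c * (N : ℂ)), add_div (c * (N : ℂ)),
    mul_div_cancel_right₀ c (Nat.cast_ne_zero.2 hN)]

theorem eventually_norm_prod_le_of_leadingCoeff_lt (h : ℂ) {l₁ l₂ : List (ℂ × ℂ)}
    (hlen : l₁.length = l₂.length)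
    (hlt : ‖(l₁.map Prod.fst).prod‖ < ‖(l₂.map Prod.fst).prod‖) :
    ∀ᶠ N : ℕ in atTop, ‖(l₁.map fun p : ℂ × ℂ => p.1 * (h + N) + p.2).prod‖ ≤
      ‖(l₂.map fun p : ℂ × ℂ => p.1 * (h + N) + p.2).prod‖ := by
  have hlim (l : List (ℂ × ℂ)) :
      Tendsto (fun N : ℕ => ‖(l.map fun p : ℂ × ℂ => (p.1 * (h + N) + p.2) / N).prod‖) atTop
        (𝓝 ‖(l.map Prod.fst).prod‖) :=
    (tendsto_list_prod l fun p _ => tendsto_mul_add_natCast_add_div h p.1 p.2).norm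
  filter_upwards [(hlim l₁).eventually_lt (hlim l₂) hlt] with N hN
  simp only [div_eq_mul_inv, List.prod_map_mul, List.map_const', List.prod_replicate, norm_mul,
    hlen] at hN
  exact (lt_of_mul_lt_mul_right hN (norm_nonneg _)).le

theorem tendsto_Gamma_mul_div_Gamma_mul {a b c d : ℂ} (h : a + b = c + d) :
    Tendsto (fun n : ℕ => Complex.Gamma (a + n) * Complex.Gamma (b + n) /
      (Complex.Gamma (c + n) * Complex.Gamma (d + n))) atTop (𝓝 1) := by
  rw [← tendsto_add_atTop_iff_nat 1]
  have hlim := ((tendsto_cpow_mul_factorial_mul_inv_Gamma c).mul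
    (tendsto_cpow_mul_factorial_mul_inv_Gamma d)).div
    ((tendsto_cpow_mul_factorial_mul_inv_Gamma a).mul
      (tendsto_cpow_mul_factorial_mul_inv_Gamma b)) (by norm_num)
  rw [mul_one, div_one] at hlim
  refine hlim.congr' ?_
  filter_upwards [eventually_ne_atTop 0] with n hn
  have hn' : (n : ℂ) ≠ 0 := Nat.cast_ne_zero.2 hn
  have hpow : (n : ℂ) ^ a * n ^ b = n ^ c * n ^ d := by
    rw [← Complex.cpow_add _ _ hn', h, Complex.cpow_add _ _ hn']
  have hne (e : ℂ) : (n : ℂ) ^ e ≠ 0 := by simp [Complex.cpow_eq_zero_iff, hn']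
  have hfactorial : (n.factorial : ℂ) ≠ 0 := Nat.cast_ne_zero.2 n.factorial_ne_zero
  have hscale : (n : ℂ) ^ c * n.factorial * (n ^ d * n.factorial) =
      n ^ a * n.factorial * (n ^ b * n.factorial) := by
    linear_combination -(n.factorial : ℂ) ^ 2 * hpow
  rw [Pi.div_apply, mul_mul_mul_comm (_ ^ c * _), hscale,
    mul_mul_mul_comm _ (Complex.Gamma (a + _))⁻¹,
    mul_div_mul_left _ _ (by simp [hne, hfactorial]), ← mul_inv, ← mul_inv, inv_div_inv]

theorem tendsto_Gamma_two_mul_div_Gamma_two_mul {a b c d : ℂ} (hadd : a + b = c + d) :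
    Tendsto (fun N : ℕ => Complex.Gamma (a + 2 * N) * Complex.Gamma (b + 2 * N) /
      (Complex.Gamma (c + 2 * N) * Complex.Gamma (d + 2 * N))) atTop (𝓝 1) := by
  refine ((tendsto_Gamma_mul_div_Gamma_mul hadd).comp
    (tendsto_id.const_mul_atTop' two_pos)).congr fun N => ?_
  simp only [Function.comp_apply, id, Nat.cast_mul, Nat.cast_ofNat]

theorem Gamma_eq_mul_div_of_Gamma_add_half_ne_zero {s : ℂ} (hs : Complex.Gamma (s + 1 / 2) ≠ 0) :
    Complex.Gamma s =
      2 ^ (1 - 2 * s) * √Real.pi * (Complex.Gamma (2 * s) / Complex.Gamma (s + 1 / 2)) := by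
  rw [← mul_div_assoc, eq_div_iff hs, Complex.Gamma_mul_Gamma_add_half]
  ring

theorem Gamma_mul_div_Gamma_mul_eq_duplication {s₁ s₂ s₃ s₄ : ℂ} (hs : s₁ + s₂ = s₃ + s₄)
    (h₁ : Complex.Gamma (s₁ + 1 / 2) ≠ 0) (h₂ : Complex.Gamma (s₂ + 1 / 2) ≠ 0)
    (h₃ : Complex.Gamma (s₃ + 1 / 2) ≠ 0) (h₄ : Complex.Gamma (s₄ + 1 / 2) ≠ 0) :
    Complex.Gamma s₁ * Complex.Gamma s₂ / (Complex.Gamma s₃ * Complex.Gamma s₄) =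
      Complex.Gamma (s₃ + 1 / 2) * Complex.Gamma (s₄ + 1 / 2) /
        (Complex.Gamma (s₁ + 1 / 2) * Complex.Gamma (s₂ + 1 / 2)) *
      (Complex.Gamma (2 * s₁) * Complex.Gamma (2 * s₂) /
        (Complex.Gamma (2 * s₃) * Complex.Gamma (2 * s₄))) := by
  have hpow : (2 : ℂ) ^ (1 - 2 * s₁) * √Real.pi * (2 ^ (1 - 2 * s₂) * √Real.pi) =
      2 ^ (1 - 2 * s₃) * √Real.pi * (2 ^ (1 - 2 * s₄) * √Real.pi) := by
    rw [mul_mul_mul_comm, mul_mul_mul_comm (2 ^ (1 - 2 * s₃)),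
      ← Complex.cpow_add _ _ two_ne_zero, ← Complex.cpow_add _ _ two_ne_zero,
      show 1 - 2 * s₁ + (1 - 2 * s₂) = 1 - 2 * s₃ + (1 - 2 * s₄) by linear_combination -2 * hs]
  have hne : (2 : ℂ) ^ (1 - 2 * s₃) * √Real.pi * (2 ^ (1 - 2 * s₄) * √Real.pi) ≠ 0 := by
    simp [Complex.cpow_eq_zero_iff, Real.pi_pos.le, Real.pi_ne_zero]
  rw [Gamma_eq_mul_div_of_Gamma_add_half_ne_zero h₁, Gamma_eq_mul_div_of_Gamma_add_half_ne_zero h₂,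
    Gamma_eq_mul_div_of_Gamma_add_half_ne_zero h₃, Gamma_eq_mul_div_of_Gamma_add_half_ne_zero h₄,
    mul_mul_mul_comm, hpow, mul_mul_mul_comm _ (Complex.Gamma (2 * s₃) / _),
    mul_div_mul_left _ _ hne]
  simp only [div_eq_mul_inv, mul_inv, inv_inv]
  ring

theorem NotNonposInt.Gamma_add_half_ne_zero {s : ℂ} (hs : NotNonposInt (2 * s)) :
    Complex.Gamma (s + 1 / 2) ≠ 0 :=
  Complex.Gamma_ne_zero fun m hm => hs (2 * m + 1) (by push_cast; linear_combination 2 * hm)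

/-! ### Systems of two linear recurrences -/

theorem eventually_eq_zero_of_norm_le_succ {E : ℕ → ℂ} (hE : Tendsto E atTop (𝓝 0))
    (hle : ∀ᶠ n in atTop, ‖E n‖ ≤ ‖E (n + 1)‖) : ∀ᶠ n in atTop, E n = 0 := by
  obtain ⟨N, hN⟩ := eventually_atTop.1 hle
  filter_upwards [eventually_ge_atTop N] with n hn
  have hmono (k : ℕ) : ‖E n‖ ≤ ‖E (n + k)‖ := by
    induction k with
    | zero => exact le_rfl
    | succ k ih => exact ih.trans (hN (n + k) (by omega))
  have hlim : Tendsto (fun k => ‖E (n + k)‖) atTop (𝓝 0) := by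
    simpa [add_comm, norm_zero] using ((tendsto_add_atTop_iff_nat n).2 hE).norm
  exact norm_le_zero_iff.1 (ge_of_tendsto' hlim hmono)

section LinearSystem

variable {p a b r c d f l u v P Q : ℕ → ℂ}

theorem eventually_casoratian_eq_zero
    (hf : ∀ n, p n * f n = a n * f (n + 1) + b n * l n)
    (hl : ∀ n, r n * l n = c n * f (n + 1) + d n * l (n + 1))
    (hu : ∀ n, p n * u n = a n * u (n + 1) + b n * v n)
    (hv : ∀ n, r n * v n = c n * u (n + 1) + d n * v (n + 1))
    (hp : ∀ n, p n ≠ 0) (hr : ∀ n, r n ≠ 0)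
    (hf_lim : Tendsto (fun n => P n * f n) atTop (𝓝 1))
    (hl_lim : Tendsto (fun n => Q n * l n) atTop (𝓝 1))
    (hu_lim : Tendsto (fun n => P n * u n) atTop (𝓝 1))
    (hv_lim : Tendsto (fun n => Q n * v n) atTop (𝓝 1))
    (hle : ∀ᶠ n in atTop,
      ‖a n * d n * (P n * Q n)‖ ≤ ‖p n * r n * (P (n + 1) * Q (n + 1))‖) :
    ∀ᶠ n in atTop, f n * v n - u n * l n = 0 := by
  have hlim : Tendsto (fun n => P n * Q n * (f n * v n - u n * l n)) atTop (𝓝 0) := by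
    have h := (hf_lim.mul hv_lim).sub (hu_lim.mul hl_lim)
    rw [sub_self] at h
    exact h.congr fun n => by ring
  have hstep (n : ℕ) : p n * r n * (f n * v n - u n * l n) =
      a n * d n * (f (n + 1) * v (n + 1) - u (n + 1) * l (n + 1)) := by
    linear_combination r n * v n * hf n - r n * l n * hu n +
      a n * f (n + 1) * hv n - a n * u (n + 1) * hl n
  have hP := hf_lim.eventually_ne one_ne_zero
  have hQ := hl_lim.eventually_ne one_ne_zero
  have hzero := eventually_eq_zero_of_norm_le_succ hlim ?_
  · filter_upwards [hzero, hP, hQ] with n hn hPn hQn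
    exact (mul_eq_zero.1 hn).resolve_left
      (mul_ne_zero (left_ne_zero_of_mul hPn) (left_ne_zero_of_mul hQn))
  filter_upwards [hle, (tendsto_add_atTop_nat 1).eventually hP,
    (tendsto_add_atTop_nat 1).eventually hQ] with n hn hPn hQn
  have hpos : 0 < ‖p n * r n * (P (n + 1) * Q (n + 1))‖ :=
    norm_pos_iff.2 (mul_ne_zero (mul_ne_zero (hp n) (hr n))
      (mul_ne_zero (left_ne_zero_of_mul hPn) (left_ne_zero_of_mul hQn)))
  refine le_of_mul_le_mul_left ?_ hpos
  calc ‖p n * r n * (P (n + 1) * Q (n + 1))‖ * ‖P n * Q n * (f n * v n - u n * l n)‖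
      = ‖a n * d n * (P n * Q n)‖ *
          ‖P (n + 1) * Q (n + 1) * (f (n + 1) * v (n + 1) - u (n + 1) * l (n + 1))‖ := by
        rw [← norm_mul, ← norm_mul]
        congr 1
        linear_combination P (n + 1) * Q (n + 1) * P n * Q n * hstep n
    _ ≤ _ := mul_le_mul_of_nonneg_right hn (norm_nonneg _)

theorem eventually_eq_of_casoratian_eq_zero
    (hl : ∀ n, r n * l n = c n * f (n + 1) + d n * l (n + 1))
    (hv : ∀ n, r n * v n = c n * u (n + 1) + d n * v (n + 1))
    (hr : ∀ n, r n ≠ 0)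
    (hf_lim : Tendsto (fun n => P n * f n) atTop (𝓝 1))
    (hu_lim : Tendsto (fun n => P n * u n) atTop (𝓝 1))
    (hv_lim : Tendsto (fun n => Q n * v n) atTop (𝓝 1))
    (hzero : ∀ᶠ n in atTop, f n * v n - u n * l n = 0) :
    ∀ᶠ n in atTop, f n = u n ∧ l n = v n := by
  have hu_ne := hu_lim.eventually_ne one_ne_zero
  have hv_ne := hv_lim.eventually_ne one_ne_zero
  have hratio : ∀ᶠ n in atTop, f n = f n / u n * u n ∧ l n = f n / u n * v n := by
    filter_upwards [hu_ne, hzero] with n hun hn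
    have hun' := right_ne_zero_of_mul hun
    refine ⟨(div_mul_cancel₀ _ hun').symm, ?_⟩
    rw [div_mul_eq_mul_div, eq_div_iff hun']
    linear_combination -hn
  have hlim : Tendsto (fun n => f n / u n - 1) atTop (𝓝 0) := by
    have h := (hf_lim.div hu_lim one_ne_zero).sub_const 1
    rw [div_one, sub_self] at h
    refine h.congr' ?_
    filter_upwards [hu_ne] with n hn
    rw [Pi.div_apply, mul_div_mul_left _ _ (left_ne_zero_of_mul hn)]
  have hone := eventually_eq_zero_of_norm_le_succ hlim ?_
  · filter_upwards [hone, hratio] with n hn hrn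
    rw [sub_eq_zero.1 hn, one_mul, one_mul] at hrn
    exact hrn
  filter_upwards [hratio, (tendsto_add_atTop_nat 1).eventually hratio, hv_ne] with n h₀ h₁ hvn
  obtain ⟨hf₁, hl₁⟩ := h₁
  have hconst : f n / u n = f (n + 1) / u (n + 1) := by
    refine mul_right_cancel₀ (mul_ne_zero (hr n) (right_ne_zero_of_mul hvn)) ?_
    linear_combination hl n - r n * h₀.2 + c n * hf₁ + d n * hl₁ -
      f (n + 1) / u (n + 1) * hv n
  rw [hconst]

/-- The Casoratian of the two solutions is governed by a first-order recurrence, whose only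
normalized null solution is zero; hence the solutions are proportional, and their limits make
the factor one. -/
theorem eq_of_linear_system
    (hf : ∀ n, p n * f n = a n * f (n + 1) + b n * l n)
    (hl : ∀ n, r n * l n = c n * f (n + 1) + d n * l (n + 1))
    (hu : ∀ n, p n * u n = a n * u (n + 1) + b n * v n)
    (hv : ∀ n, r n * v n = c n * u (n + 1) + d n * v (n + 1))
    (hp : ∀ n, p n ≠ 0) (hr : ∀ n, r n ≠ 0)
    (hf_lim : Tendsto (fun n => P n * f n) atTop (𝓝 1))
    (hl_lim : Tendsto (fun n => Q n * l n) atTop (𝓝 1))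
    (hu_lim : Tendsto (fun n => P n * u n) atTop (𝓝 1))
    (hv_lim : Tendsto (fun n => Q n * v n) atTop (𝓝 1))
    (hle : ∀ᶠ n in atTop,
      ‖a n * d n * (P n * Q n)‖ ≤ ‖p n * r n * (P (n + 1) * Q (n + 1))‖) (n : ℕ) :
    f n = u n ∧ l n = v n := by
  have hzero := eventually_casoratian_eq_zero hf hl hu hv hp hr hf_lim hl_lim hu_lim hv_lim hle
  obtain ⟨N, hN⟩ := ((eventually_eq_of_casoratian_eq_zero hl hv hr hf_lim hu_lim hv_lim
    hzero).and (eventually_ge_atTop n)).exists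
  refine Nat.decreasingInduction' (fun k _ _ hk => ?_) hN.2 hN.1
  have hlv : l k = v k := mul_left_cancel₀ (hr k) (by rw [hl, hv, hk.1, hk.2])
  exact ⟨mul_left_cancel₀ (hp k) (by rw [hf, hu, hk.1, hlv]), hlv⟩

end LinearSystem

theorem tendsto_re_add_natCast_add (h b : ℂ) :
    Tendsto (fun N : ℕ => (h + N + b).re) atTop atTop := by
  simp only [Complex.add_re, Complex.natCast_re]
  exact tendsto_atTop_add_const_right _ _
    (tendsto_atTop_add_const_left _ _ tendsto_natCast_atTop_atTop)

theorem tendsto_re_two_mul_add_natCast_add (h b : ℂ) :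
    Tendsto (fun N : ℕ => (2 * (h + N) + b).re) atTop atTop := by
  have hlim := (tendsto_re_add_natCast_add h (b - h)).atTop_add_atTop
    (tendsto_re_add_natCast_add h h)
  refine hlim.congr fun N => ?_
  rw [← Complex.add_re]
  ring_nf

section Limits

variable (h x y : ℂ)

theorem tendsto_Gamma_mul_tsum_threeTerm :
    Tendsto (fun N : ℕ => Complex.Gamma (2 * (h + N) - x + y) * Complex.Gamma (h + N + x + y) *
      ∑' k, threeTerm (h + N) x y k) atTop (𝓝 1) := by
  refine (tendsto_tsum_regularizedTerm (2 * y) (x + y)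
    (tendsto_re_two_mul_add_natCast_add h (-x + y))
    (l := [(fun N => h + N + (x + y), -2 * x)]) ?_).congr fun N => ?_
  · simpa only [List.mem_singleton, forall_eq] using tendsto_re_add_natCast_add h (x + y)
  · simp only [threeTerm, regularizedTerm, List.map_cons, List.map_nil, List.prod_cons,
      List.prod_nil]
    congr 1
    · ring_nf
    · exact tsum_congr fun k => by ring_nf

theorem tendsto_Gamma_mul_tsum_threeTermCompanion :
    Tendsto (fun N : ℕ => Complex.Gamma (2 * (h + N) - x + y + 2) *
      Complex.Gamma (h + N + x + y + 1) * ∑' k, threeTermCompanion (h + N) x y k)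
      atTop (𝓝 1) := by
  refine (tendsto_tsum_regularizedTerm (2 * y + 1) (x + y)
    (tendsto_re_two_mul_add_natCast_add h (-x + y + 2))
    (l := [(fun N => h + N + (x + y + 1), -2 * x)]) ?_).congr fun N => ?_
  · simpa only [List.mem_singleton, forall_eq] using tendsto_re_add_natCast_add h (x + y + 1)
  · simp only [threeTermCompanion, List.map_cons, List.map_nil, List.prod_cons, List.prod_nil]
    ring_nf

theorem tendsto_Gamma_mul_tsum_fiveTerm :
    Tendsto (fun N : ℕ => Complex.Gamma (2 * (h + N) - x) * Complex.Gamma (2 * (h + N) - y) *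
      (Complex.Gamma (h + N + x) * Complex.Gamma (h + N + y)) * ∑' k, fiveTerm (h + N) x y k)
      atTop (𝓝 1) := by
  refine (tendsto_tsum_regularizedTerm x y (tendsto_re_two_mul_add_natCast_add h (-x))
    (l := [(fun N => 2 * (h + N) + -y, y - 1), (fun N => h + N + x, -2 * x),
      (fun N => h + N + y, -2 * y)]) ?_).congr fun N => ?_
  · simp only [List.forall_mem_cons, List.not_mem_nil, false_imp_iff, implies_true, and_true]
    exact ⟨tendsto_re_two_mul_add_natCast_add h (-y), tendsto_re_add_natCast_add h x,
      tendsto_re_add_natCast_add h y⟩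
  · simp only [fiveTerm, regularizedTerm, List.map_cons, List.map_nil, List.prod_cons,
      List.prod_nil]
    congr 1
    · ring_nf
    · exact tsum_congr fun k => by ring_nf

theorem tendsto_Gamma_mul_tsum_fiveTermCompanion :
    Tendsto (fun N : ℕ => Complex.Gamma (2 * (h + N) - x + 2) *
      Complex.Gamma (2 * (h + N) - y + 1) *
      (Complex.Gamma (h + N + x + 1) * Complex.Gamma (h + N + y + 1)) *
      ∑' k, fiveTermCompanion (h + N) x y k) atTop (𝓝 1) := by
  refine (tendsto_tsum_regularizedTerm (y + 1) x (tendsto_re_two_mul_add_natCast_add h (-x + 2))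
    (l := [(fun N => 2 * (h + N) + (-y + 1), y), (fun N => h + N + (x + 1), -2 * x),
      (fun N => h + N + (y + 1), -2 * y)]) ?_).congr fun N => ?_
  · simp only [List.forall_mem_cons, List.not_mem_nil, false_imp_iff, implies_true, and_true]
    exact ⟨tendsto_re_two_mul_add_natCast_add h (-y + 1), tendsto_re_add_natCast_add h (x + 1),
      tendsto_re_add_natCast_add h (y + 1)⟩
  · simp only [fiveTermCompanion, regularizedTerm, List.map_cons, List.map_nil, List.prod_cons,
      List.prod_nil]
    congr 1
    · ring_nf
    · exact tsum_congr fun k => by ring_nf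

end Limits

/-! ### The transformation of `₃F₂` into `₅F₄` -/

/-- The sum of `fiveTerm h x y`, scaled to agree with the sum of `threeTerm h x y`. -/
noncomputable def scaledFiveSum (h x y : ℂ) : ℂ :=
  Complex.Gamma h * Complex.Gamma (2 * h - 2 * y) * ∑' k, fiveTerm h x y k

/-- The sum of `fiveTermCompanion h x y`, scaled to agree with the sum of
`threeTermCompanion h x y`. -/
noncomputable def scaledFiveCompanionSum (h x y : ℂ) : ℂ :=
  Complex.Gamma (h + 1) * Complex.Gamma (2 * h - 2 * y + 1) * ∑' k, fiveTermCompanion h x y k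

section Relations

variable {h x y : ℂ}

theorem two_mul_sub_two_mul_ne_zero (hre : y.re < h.re) : 2 * h - 2 * y ≠ 0 := by
  rw [← mul_sub]
  exact mul_ne_zero two_ne_zero (sub_ne_zero.2 fun heq => hre.ne (congrArg Complex.re heq.symm))

theorem Gamma_two_mul_sub_two_mul_add_one (hre : y.re < h.re) :
    Complex.Gamma (2 * h - 2 * y + 1) = (2 * h - 2 * y) * Complex.Gamma (2 * h - 2 * y) :=
  Complex.Gamma_add_one _ (two_mul_sub_two_mul_ne_zero hre)

theorem Gamma_two_mul_add_one_sub_two_mul (hre : y.re < h.re) :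
    Complex.Gamma (2 * (h + 1) - 2 * y) =
      (2 * h - 2 * y + 1) * Complex.Gamma (2 * h - 2 * y + 1) := by
  have hne : 2 * h - 2 * y + 1 ≠ 0 := fun heq => by
    have := congrArg Complex.re heq
    simp only [Complex.add_re, Complex.sub_re, Complex.mul_re, Complex.re_ofNat, Complex.im_ofNat,
      zero_mul, sub_zero, Complex.one_re, Complex.zero_re] at this
    linarith
  rw [← Complex.Gamma_add_one _ hne]
  ring_nf

theorem scaledFiveSum_relation (hre : y.re < h.re) (hre' : -1 < 2 * h.re) (hh : h ≠ 0) :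
    (h - y) * scaledFiveSum h x y =
      h * (2 * h - x) * (h + x - y) * (2 * h - x - y + 1) * scaledFiveSum (h + 1) x y +
      h * y * (10 * h ^ 2 - 6 * h * (x + y) + 4 * x * y + 3 * h - x - y) *
        scaledFiveCompanionSum h x y := by
  simp only [scaledFiveSum, scaledFiveCompanionSum, Complex.Gamma_add_one h hh,
    Gamma_two_mul_add_one_sub_two_mul hre, Gamma_two_mul_sub_two_mul_add_one hre]
  linear_combination (h - y) * Complex.Gamma h * Complex.Gamma (2 * h - 2 * y) *
    tsum_fiveTerm_relation (x := x) (y := y) hre'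

theorem scaledFiveCompanionSum_relation (hre : y.re < h.re) (hre' : -1 < 2 * h.re) :
    (2 * h - 2 * y + 1) * (2 * h - x + 2) * scaledFiveCompanionSum h x y =
      (5 * h ^ 2 + 8 * h + 3 - 3 * h * x - 3 * h * y - 2 * x - 3 * y + 2 * x * y) *
          scaledFiveSum (h + 1) x y -
      (h + 1) * (2 * h - 2 * x + 3) * (h - x + 1) * (2 * h - x - y + 2) * (h - x + y + 1) *
        scaledFiveCompanionSum (h + 1) x y := by
  have hh : h + 1 ≠ 0 := fun heq => by
    have := congrArg Complex.re heq
    simp only [Complex.add_re, Complex.one_re, Complex.zero_re] at this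
    linarith
  have hre₁ : y.re < (h + 1).re := by
    rw [Complex.add_re, Complex.one_re]
    linarith
  simp only [scaledFiveSum, scaledFiveCompanionSum, Complex.Gamma_add_one _ hh,
    Gamma_two_mul_sub_two_mul_add_one hre₁, Gamma_two_mul_add_one_sub_two_mul hre]
  linear_combination (2 * h - 2 * y + 1) * Complex.Gamma (h + 1) *
    Complex.Gamma (2 * h - 2 * y + 1) * tsum_fiveTermCompanion_relation (x := x) (y := y) hre'

end Relations

section Limits

variable (h x y : ℂ)

theorem tendsto_Gamma_mul_scaledFiveSum :
    Tendsto (fun N : ℕ => Complex.Gamma (2 * (h + N) - x + y) * Complex.Gamma (h + N + x + y) *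
      scaledFiveSum (h + N) x y) atTop (𝓝 1) := by
  have hone := tendsto_Gamma_mul_div_Gamma_mul (a := h) (b := h + x + y) (c := h + x)
    (d := h + y) (by ring)
  have htwo := tendsto_Gamma_two_mul_div_Gamma_two_mul (a := 2 * h - 2 * y)
    (b := 2 * h - x + y) (c := 2 * h - x) (d := 2 * h - y) (by ring)
  have hsum := tendsto_Gamma_mul_tsum_fiveTerm h x y
  have hlim := (htwo.mul hone).mul hsum
  rw [one_mul, one_mul] at hlim
  refine hlim.congr' ?_
  filter_upwards [hsum.eventually_ne one_ne_zero] with N hN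
  have e₁ : h + x + N = h + N + x := by ring
  have e₂ : h + y + N = h + N + y := by ring
  have e₃ : 2 * h - x + 2 * N = 2 * (h + N) - x := by ring
  have e₄ : 2 * h - y + 2 * N = 2 * (h + N) - y := by ring
  rw [e₁, e₂, e₃, e₄, div_mul_div_comm, ← mul_assoc,
    div_mul_cancel₀ _ (left_ne_zero_of_mul hN), scaledFiveSum]
  ring_nf

theorem tendsto_Gamma_mul_scaledFiveCompanionSum :
    Tendsto (fun N : ℕ => Complex.Gamma (2 * (h + N) - x + y + 2) *
      Complex.Gamma (h + N + x + y + 1) * scaledFiveCompanionSum (h + N) x y) atTop (𝓝 1) := by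
  have hone := tendsto_Gamma_mul_div_Gamma_mul (a := h + 1) (b := h + x + y + 1)
    (c := h + x + 1) (d := h + y + 1) (by ring)
  have htwo := tendsto_Gamma_two_mul_div_Gamma_two_mul (a := 2 * h - 2 * y + 1)
    (b := 2 * h - x + y + 2) (c := 2 * h - x + 2) (d := 2 * h - y + 1) (by ring)
  have hsum := tendsto_Gamma_mul_tsum_fiveTermCompanion h x y
  have hlim := (htwo.mul hone).mul hsum
  rw [one_mul, one_mul] at hlim
  refine hlim.congr' ?_
  filter_upwards [hsum.eventually_ne one_ne_zero] with N hN
  have e₁ : h + x + 1 + N = h + N + x + 1 := by ring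
  have e₂ : h + y + 1 + N = h + N + y + 1 := by ring
  have e₃ : 2 * h - x + 2 + 2 * N = 2 * (h + N) - x + 2 := by ring
  have e₄ : 2 * h - y + 1 + 2 * N = 2 * (h + N) - y + 1 := by ring
  rw [e₁, e₂, e₃, e₄, div_mul_div_comm, ← mul_assoc,
    div_mul_cancel₀ _ (left_ne_zero_of_mul hN), scaledFiveCompanionSum]
  ring_nf

theorem eventually_Gamma_mul_Gamma_add_natCast_succ :
    ∀ᶠ N : ℕ in atTop,
      Complex.Gamma (2 * (h + (N + 1 : ℕ)) - x + y) * Complex.Gamma (h + (N + 1 : ℕ) + x + y) *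
          (Complex.Gamma (2 * (h + (N + 1 : ℕ)) - x + y + 2) *
            Complex.Gamma (h + (N + 1 : ℕ) + x + y + 1)) =
        (2 * (h + N) - x + y) * (2 * (h + N) - x + y + 1) * (h + N + x + y) *
          (2 * (h + N) - x + y + 2) * (2 * (h + N) - x + y + 3) * (h + N + x + y + 1) *
        (Complex.Gamma (2 * (h + N) - x + y) * Complex.Gamma (h + N + x + y) *
          (Complex.Gamma (2 * (h + N) - x + y + 2) * Complex.Gamma (h + N + x + y + 1))) := by
  filter_upwards [(tendsto_re_two_mul_add_natCast_add h (-x + y)).eventually_gt_atTop 0,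
    (tendsto_re_add_natCast_add h (x + y)).eventually_gt_atTop 0] with N hz hw
  have hz' : 0 < (2 * (h + N) + (-x + y) + 2).re := by
    rw [Complex.add_re _ 2, Complex.re_ofNat]
    linarith
  have e₁ : 2 * (h + (N + 1 : ℕ)) - x + y = 2 * (h + N) + (-x + y) + 2 := by
    push_cast
    ring
  have e₂ : h + (N + 1 : ℕ) + x + y + 1 = h + N + (x + y) + 2 := by
    push_cast
    ring
  have e₃ : h + (N + 1 : ℕ) + x + y = h + N + x + y + 1 := by
    push_cast
    ring
  have e₄ : 2 * (h + N) - x + y = 2 * (h + N) + (-x + y) := by ring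
  rw [e₁, e₂, e₃, e₄, Gamma_add_two hz', Gamma_add_two hw]
  have e₅ : h + N + (x + y) = h + N + x + y := by ring
  rw [Gamma_add_two hz, e₅]
  ring

/-- The leading coefficients of the two sides, as polynomials in `N`, are `16` and `64`. -/
theorem eventually_norm_coefficients_le :
    ∀ᶠ N : ℕ in atTop,
      ‖(h + N) * (2 * (h + N) - x) * (h + N + x - y) * (2 * (h + N) - x - y + 1) *
          -((h + N + 1) * (2 * (h + N) - 2 * x + 3) * (h + N - x + 1) *
            (2 * (h + N) - x - y + 2) * (h + N - x + y + 1))‖ ≤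
        ‖(h + N - y) * ((2 * (h + N) - 2 * y + 1) * (2 * (h + N) - x + 2)) *
          ((2 * (h + N) - x + y) * (2 * (h + N) - x + y + 1) * (h + N + x + y) *
            (2 * (h + N) - x + y + 2) * (2 * (h + N) - x + y + 3) * (h + N + x + y + 1))‖ := by
  have hle := eventually_norm_prod_le_of_leadingCoeff_lt h
    (l₁ := [(1, 0), (2, -x), (1, x - y), (2, -x - y + 1), (1, 1), (2, -(2 * x) + 3), (1, -x + 1),
      (2, -x - y + 2), (1, -x + y + 1)])
    (l₂ := [(1, -y), (2, -(2 * y) + 1), (2, -x + 2), (2, -x + y), (2, -x + y + 1), (1, x + y),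
      (2, -x + y + 2), (2, -x + y + 3), (1, x + y + 1)]) rfl (by norm_num)
  filter_upwards [hle] with N hN
  simp only [List.map_cons, List.map_nil, List.prod_cons, List.prod_nil] at hN
  rw [mul_neg, norm_neg]
  generalize h + (N : ℂ) = t at hN ⊢
  simpa only [one_mul, mul_one, add_zero, sub_eq_add_neg, add_assoc, mul_assoc] using hN

end Limits

section Transformation

variable {h x y : ℂ}

theorem add_natCast_ne_zero_of_neg_one_lt_two_mul_re (hre : -1 < 2 * h.re) (hh : h ≠ 0) (n : ℕ) :
    h + n ≠ 0 := by
  cases n with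
  | zero => simpa using hh
  | succ n =>
    refine (NotNonposInt.of_re_pos ?_).ne_zero
    have : (0 : ℝ) ≤ n := n.cast_nonneg
    rw [Complex.add_re, Complex.natCast_re, Nat.cast_succ]
    linarith

theorem coefficients_ne_zero (hre : y.re < h.re) (hx : NotNonposInt (2 * h - x)) (n : ℕ) :
    h + n - y ≠ 0 ∧ (2 * (h + n) - 2 * y + 1) * (2 * (h + n) - x + 2) ≠ 0 := by
  have hpos : 0 < (h - y).re := by
    rw [Complex.sub_re]
    linarith
  have hpos' : 0 < (2 * (h - y)).re := by
    simpa using hpos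
  refine ⟨?_, mul_ne_zero ?_ ?_⟩
  · convert (NotNonposInt.of_re_pos hpos).add_natCast_ne_zero n using 1
    ring
  · convert (NotNonposInt.of_re_pos hpos').add_natCast_ne_zero (2 * n + 1) using 1
    push_cast
    ring
  · convert hx.add_natCast_ne_zero (2 * n + 2) using 1
    push_cast
    ring

theorem re_lt_re_add_natCast (hre : y.re < h.re) (hre' : -1 < 2 * h.re) (n : ℕ) :
    y.re < (h + n).re ∧ -1 < 2 * (h + n).re := by
  have : (0 : ℝ) ≤ n := n.cast_nonneg
  rw [Complex.add_re, Complex.natCast_re]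
  constructor <;> linarith

/-- Both sides, together with the companion sums, satisfy the same pair of recurrences in `h`. -/
theorem tsum_threeTerm_eq_scaledFiveSum (hre : y.re < h.re) (hre' : -1 < 2 * h.re) (hh : h ≠ 0)
    (hx : NotNonposInt (2 * h - x)) :
    ∑' k, threeTerm h x y k = scaledFiveSum h x y := by
  have hre_add := re_lt_re_add_natCast hre hre'
  have key := eq_of_linear_system
    (p := fun n => h + n - y)
    (a := fun n => (h + n) * (2 * (h + n) - x) * (h + n + x - y) * (2 * (h + n) - x - y + 1))
    (b := fun n => (h + n) * y * (10 * (h + n) ^ 2 - 6 * (h + n) * (x + y) + 4 * x * y +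
      3 * (h + n) - x - y))
    (r := fun n => (2 * (h + n) - 2 * y + 1) * (2 * (h + n) - x + 2))
    (c := fun n => 5 * (h + n) ^ 2 + 8 * (h + n) + 3 - 3 * (h + n) * x - 3 * (h + n) * y -
      2 * x - 3 * y + 2 * x * y)
    (d := fun n => -((h + n + 1) * (2 * (h + n) - 2 * x + 3) * (h + n - x + 1) *
      (2 * (h + n) - x - y + 2) * (h + n - x + y + 1)))
    (f := fun n => ∑' k, threeTerm (h + n) x y k)
    (l := fun n => ∑' k, threeTermCompanion (h + n) x y k)
    (u := fun n => scaledFiveSum (h + n) x y)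
    (v := fun n => scaledFiveCompanionSum (h + n) x y)
    ?_ ?_ ?_ ?_ (fun n => (coefficients_ne_zero hre hx n).1)
    (fun n => (coefficients_ne_zero hre hx n).2)
    (tendsto_Gamma_mul_tsum_threeTerm h x y) (tendsto_Gamma_mul_tsum_threeTermCompanion h x y)
    (tendsto_Gamma_mul_scaledFiveSum h x y) (tendsto_Gamma_mul_scaledFiveCompanionSum h x y)
    ?_ 0
  · simpa only [Nat.cast_zero, add_zero] using key.1
  · exact fun n => by
      simpa only [Nat.cast_succ, ← add_assoc] using tsum_threeTerm_relation (hre_add n).1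
  · intro n
    simp only [Nat.cast_succ, ← add_assoc]
    linear_combination tsum_threeTermCompanion_relation (x := x) (hre_add n).1
  · exact fun n => by
      simpa only [Nat.cast_succ, ← add_assoc] using scaledFiveSum_relation (hre_add n).1
        (hre_add n).2 (add_natCast_ne_zero_of_neg_one_lt_two_mul_re hre' hh n)
  · intro n
    simp only [Nat.cast_succ, ← add_assoc]
    linear_combination scaledFiveCompanionSum_relation (x := x) (hre_add n).1 (hre_add n).2
  · filter_upwards [eventually_norm_coefficients_le h x y,
      eventually_Gamma_mul_Gamma_add_natCast_succ h x y] with n hn hgamma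
    rw [hgamma, norm_mul, ← mul_assoc (_ * (_ * _)), norm_mul (_ * (_ * _) * _)]
    exact mul_le_mul_of_nonneg_right hn (norm_nonneg _)

theorem hypergeometricF_three_two_eq_five_four (hre : 0 < (2 * h - 2 * y).re)
    (hre' : 0 < (2 * h + 1).re) (hh : h ≠ 0) (h₁ : NotNonposInt (2 * h - x + y))
    (h₂ : NotNonposInt (h + x + y)) (h₃ : NotNonposInt (2 * h - x)) (h₄ : NotNonposInt (h + y))
    (h₅ : NotNonposInt (2 * h - y)) (h₆ : NotNonposInt (h + x)) :
    hypergeometricF [2 * y, h - x + y, x + y] [2 * h - x + y, h + x + y] 1 =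
      Complex.Gamma h * Complex.Gamma (2 * h - x + y) /
          (Complex.Gamma (h + y) * Complex.Gamma (2 * h - x)) *
        (Complex.Gamma (h + x + y) * Complex.Gamma (2 * h - 2 * y) /
          (Complex.Gamma (h + x) * Complex.Gamma (2 * h - y))) *
        hypergeometricF [2 * h - 1, x, h - y, y, h - x]
          [2 * h - x, h + y, 2 * h - y, h + x] 1 := by
  have hcore := tsum_threeTerm_eq_scaledFiveSum (h := h) (y := y) (by simpa using hre)
    (by simpa [neg_lt_iff_pos_add] using hre') hh h₃
  have hfour : ∀ b ∈ [2 * h - x, h + y, 2 * h - y, h + x], NotNonposInt b := by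
    simp [h₃, h₄, h₅, h₆]
  simp only [threeTerm, scaledFiveSum, fiveTerm] at hcore
  rw [hypergeometricF_one_eq (by simp [h₁, h₂]), hcore, hypergeometricF_one_eq hfour]
  simp only [List.map_cons, List.map_nil, List.prod_cons, List.prod_nil]
  field_simp [h₃.Gamma_ne_zero, h₄.Gamma_ne_zero, h₅.Gamma_ne_zero, h₆.Gamma_ne_zero]

variable (h x y) in
theorem summable_and_hypergeometricF_three_two_eq_five_four (hre : 0 < (2 * h - 2 * y).re)
    (hre' : 0 < (2 * h + 1).re) (h₁ : NotNonposInt (2 * h - x + y))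
    (h₂ : NotNonposInt (h + x + y)) (h₃ : NotNonposInt (2 * h - x)) (h₄ : NotNonposInt (h + y))
    (h₅ : NotNonposInt (2 * h - y)) (h₆ : NotNonposInt (h + x))
    (h₇ : NotNonposInt (h + y + 1 / 2)) (h₈ : NotNonposInt (2 * h - x + 1 / 2))
    (h₉ : NotNonposInt (2 * h)) (h₁₀ : NotNonposInt (2 * (2 * h - x + y))) :
    Summable (hypergeometricTerm [2 * y, h - x + y, x + y] [2 * h - x + y, h + x + y] 1) ∧
      Summable (hypergeometricTerm [2 * h - 1, x, h - y, y, h - x]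
        [2 * h - x, h + y, 2 * h - y, h + x] 1) ∧
      hypergeometricF [2 * y, h - x + y, x + y] [2 * h - x + y, h + x + y] 1 =
        Complex.Gamma (h + y + 1 / 2) * Complex.Gamma (2 * h - x + 1 / 2) /
            (Complex.Gamma (h + 1 / 2) * Complex.Gamma (2 * h - x + y + 1 / 2)) *
          (Complex.Gamma (h + x + y) * Complex.Gamma (2 * h - 2 * y) * Complex.Gamma (2 * h) *
              Complex.Gamma (2 * (2 * h - x + y)) /
            (Complex.Gamma (h + x) * Complex.Gamma (2 * h - y) * Complex.Gamma (2 * (h + y)) *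
              Complex.Gamma (2 * (2 * h - x)))) *
          hypergeometricF [2 * h - 1, x, h - y, y, h - x]
            [2 * h - x, h + y, 2 * h - y, h + x] 1 := by
  have hh : h ≠ 0 := fun heq => h₉.ne_zero (by rw [heq, mul_zero])
  refine ⟨summable_hypergeometricTerm rfl (by simp [h₁, h₂]) ?_,
    summable_hypergeometricTerm rfl (by simp [h₃, h₄, h₅, h₆]) ?_, ?_⟩
  · convert hre using 2
    simp only [List.sum_cons, List.sum_nil]
    ring
  · convert hre' using 2
    simp only [List.sum_cons, List.sum_nil]
    ring
  rw [hypergeometricF_three_two_eq_five_four hre hre' hh h₁ h₂ h₃ h₄ h₅ h₆,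
    Gamma_mul_div_Gamma_mul_eq_duplication (by ring) h₉.Gamma_add_half_ne_zero
      h₁₀.Gamma_add_half_ne_zero h₇.Gamma_ne_zero h₈.Gamma_ne_zero]
  simp only [div_eq_mul_inv, mul_inv]
  ring

end Transformation

/-! ### Apéry's approximations to `ζ(2)` -/

/-- The regularized term of the series `₃F₂[m + 1, m + 1, m + 1; 2m + 2, 2m + 2; 1]`, which is
up to a factor Apéry's linear form `q_m ζ(2) - p_m` when `m` is a natural number. -/
noncomputable def aperyTerm (m : ℂ) : ℕ → ℂ :=
  regularizedTerm [m + 1, m + 1, m + 1] [2 * m + 2, 2 * m + 2]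

/-- The polynomial certificate, found by Zeilberger's algorithm, of the three-term recurrence for
the sums of `aperyTerm`. -/
noncomputable def aperyCertificate (m : ℂ) : Polynomial ℂ :=
  open Polynomial in
  C (m + 1) * (X ^ 6 + C (4 * m + 7) * X ^ 5 - C (13 * m ^ 2 + 39 * m + 30) * X ^ 4
    - C (102 * m ^ 3 + 482 * m ^ 2 + 758 * m + 397) * X ^ 3
    - C (225 * m ^ 4 + 1416 * m ^ 3 + 3317 * m ^ 2 + 3427 * m + 1317) * X ^ 2
    - C (217 * m ^ 5 + 1692 * m ^ 4 + 5217 * m ^ 3 + 7942 * m ^ 2 + 5960 * m + 1760) * X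
    - C (79 * m ^ 6 + 731 * m ^ 5 + 2779 * m ^ 4 + 5549 * m ^ 3 + 6130 * m ^ 2 + 3548 * m + 840))

theorem aperyCertificate_identity (m z : ℂ) :
    (m + 1) ^ 2 * ((2 * m + 2 + z) * (2 * m + 3 + z) * (2 * m + 4 + z) * (2 * m + 5 + z)) ^ 2 =
      (11 * (m + 1) ^ 2 + 11 * (m + 1) + 3) *
        ((m + 1) * (m + 1 + z) ^ 3 * ((2 * m + 4 + z) * (2 * m + 5 + z)) ^ 2) +
      (m + 2) ^ 2 * ((m + 1) * (m + 2) * ((m + 1 + z) * (m + 2 + z)) ^ 3) -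
      ((m + 1 + z) ^ 3 * (aperyCertificate m).eval (z + 1) -
        z * (2 * m + 5 + z) ^ 2 * (aperyCertificate m).eval z) := by
  simp only [aperyCertificate, Polynomial.eval_mul, Polynomial.eval_pow, Polynomial.eval_add,
    Polynomial.eval_sub, Polynomial.eval_C, Polynomial.eval_X]
  ring

theorem natDegree_mul_aperyCertificate_le (m : ℂ) :
    ((Polynomial.C m + Polynomial.X) ^ 3 * aperyCertificate m).natDegree ≤ 9 := by
  unfold aperyCertificate
  compute_degree

/-- The common factor of the terms of the recurrence for the sums of `aperyTerm`. -/
noncomputable def aperyBase (m : ℂ) : ℕ → ℂ :=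
  regularizedTerm [m + 1, m + 1, m + 1] [2 * m + 6, 2 * m + 6]

theorem aperyTerm_eq_mul_aperyBase (m : ℂ) (k : ℕ) : aperyTerm m k =
    ((2 * m + 2 + k) * (2 * m + 3 + k) * (2 * m + 4 + k) * (2 * m + 5 + k)) ^ 2 *
      aperyBase m k := by
  simp only [aperyTerm, aperyBase, regularizedTerm, List.map_cons, List.map_nil, List.prod_cons,
    List.prod_nil, inv_Gamma_add_natCast_eq_add_one (2 * m + 2) k,
    inv_Gamma_add_natCast_eq_add_one (2 * m + 2 + 1) k,
    inv_Gamma_add_natCast_eq_add_one (2 * m + 2 + 1 + 1) k,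
    inv_Gamma_add_natCast_eq_add_one (2 * m + 2 + 1 + 1 + 1) k]
  ring_nf

theorem mul_aperyTerm_add_one_eq_mul_aperyBase (m : ℂ) (k : ℕ) :
    (m + 1) ^ 3 * aperyTerm (m + 1) k =
      (m + 1 + k) ^ 3 * ((2 * m + 4 + k) * (2 * m + 5 + k)) ^ 2 * aperyBase m k := by
  have hnum : ((m + 1) * poch (m + 1 + 1) k) ^ 3 = ((m + 1 + k) * poch (m + 1) k) ^ 3 := by
    rw [poch_add_one_mul]
  have hfour : 2 * (m + 1) + 2 = 2 * m + 4 := by ring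
  have hsix : 2 * m + 4 + 1 + 1 = 2 * m + 6 := by ring
  simp only [aperyTerm, aperyBase, regularizedTerm, List.map_cons, List.map_nil, List.prod_cons,
    List.prod_nil, hfour, inv_Gamma_add_natCast_eq_add_one (2 * m + 4) k,
    inv_Gamma_add_natCast_eq_add_one (2 * m + 4 + 1) k, hsix]
  linear_combination ((2 * m + 4 + k) * (2 * m + 4 + 1 + k) *
    (Complex.Gamma (2 * m + 6 + k))⁻¹) ^ 2 * (k.factorial : ℂ)⁻¹ * hnum

theorem mul_aperyTerm_add_two_eq_mul_aperyBase (m : ℂ) (k : ℕ) :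
    ((m + 1) * (m + 2)) ^ 3 * aperyTerm (m + 2) k =
      ((m + 1 + k) * (m + 2 + k)) ^ 3 * aperyBase m k := by
  have hnum : (m + 1) * (m + 2) * poch (m + 2 + 1) k =
      (m + 1 + k) * (m + 2 + k) * poch (m + 1) k := by
    have h := poch_add_one_mul (m + 1) k
    rw [add_assoc, one_add_one_eq_two] at h
    linear_combination (m + 1) * poch_add_one_mul (m + 2) k + (m + 2 + k) * h
  have hnum := congrArg (· ^ 3) hnum
  have hsix : 2 * (m + 2) + 2 = 2 * m + 6 := by ring
  simp only [aperyTerm, aperyBase, regularizedTerm, List.map_cons, List.map_nil, List.prod_cons,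
    List.prod_nil, hsix] at hnum ⊢
  linear_combination ((Complex.Gamma (2 * m + 6 + k))⁻¹) ^ 2 * (k.factorial : ℂ)⁻¹ * hnum

theorem mul_aperyBase_succ (m : ℂ) (k : ℕ) :
    ((k + 1 : ℕ) : ℂ) * (2 * m + 5 + (k + 1 : ℕ)) ^ 2 * aperyBase m (k + 1) =
      (m + 1 + k) ^ 3 * aperyBase m k := by
  simp only [aperyBase, regularizedTerm, List.map_cons, List.map_nil, List.prod_cons,
    List.prod_nil, poch_succ, inv_factorial_eq_add_one_mul k, inv_Gamma_add_natCast (2 * m + 6) k]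
  push_cast
  ring

theorem summable_aperyTerm {m : ℂ} (hm : -1 < m.re) : Summable (aperyTerm m) := by
  refine summable_regularizedTerm rfl ?_
  simp only [List.sum_cons, List.sum_nil, Complex.sub_re, Complex.add_re, Complex.mul_re,
    Complex.re_ofNat, Complex.im_ofNat, Complex.one_re, Complex.zero_re]
  linarith

theorem tendsto_aperyCertificate_mul_aperyBase {m : ℂ} (hm : -1 < m.re) :
    Tendsto (fun k : ℕ =>
      (m + 1 + k) ^ 3 * (aperyCertificate m).eval ((k : ℂ) + 1) * aperyBase m k) atTop (𝓝 0) := by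
  have hdegree : (((Polynomial.C m + Polynomial.X) ^ 3 * aperyCertificate m).natDegree : ℝ) ≤ 9 :=
    by exact_mod_cast natDegree_mul_aperyCertificate_le m
  refine (tendsto_eval_mul_regularizedTerm (as := [m + 1, m + 1, m + 1])
    (bs := [2 * m + 6, 2 * m + 6]) rfl (hdegree.trans_lt ?_)).congr fun k => ?_
  · simp only [List.sum_cons, List.sum_nil, Complex.sub_re, Complex.add_re, Complex.mul_re,
      Complex.re_ofNat, Complex.im_ofNat, Complex.one_re, Complex.zero_re]
    linarith
  · simp only [Polynomial.eval_mul, Polynomial.eval_pow, Polynomial.eval_add, Polynomial.eval_C,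
      Polynomial.eval_X, aperyBase]
    ring

theorem tsum_aperyTerm_recurrence {m : ℂ} (hm : -1 < m.re) :
    (m + 1) ^ 2 * ∑' k, aperyTerm m k =
      (11 * (m + 1) ^ 2 + 11 * (m + 1) + 3) * (m + 1) ^ 4 * ∑' k, aperyTerm (m + 1) k +
        (m + 1) ^ 4 * (m + 2) ^ 6 * ∑' k, aperyTerm (m + 2) k := by
  have hm₁ : -1 < (m + 1).re := by
    rw [Complex.add_re, Complex.one_re]
    linarith
  have hm₂ : -1 < (m + 2).re := by
    rw [Complex.add_re, Complex.re_ofNat]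
    linarith
  have hcert (k : ℕ) : (m + 1) ^ 2 * aperyTerm m k -
      ((11 * (m + 1) ^ 2 + 11 * (m + 1) + 3) * (m + 1) ^ 4 * aperyTerm (m + 1) k +
        (m + 1) ^ 4 * (m + 2) ^ 6 * aperyTerm (m + 2) k) =
      (k * (2 * m + 5 + k) ^ 2 * (aperyCertificate m).eval (k : ℂ) -
        (m + 1 + k) ^ 3 * (aperyCertificate m).eval ((k : ℂ) + 1)) * aperyBase m k := by
    linear_combination aperyBase m k * aperyCertificate_identity m k +
      (m + 1) ^ 2 * aperyTerm_eq_mul_aperyBase m k -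
      (11 * (m + 1) ^ 2 + 11 * (m + 1) + 3) * (m + 1) *
        mul_aperyTerm_add_one_eq_mul_aperyBase m k -
      (m + 1) * (m + 2) ^ 3 * mul_aperyTerm_add_two_eq_mul_aperyBase m k
  rw [← sub_eq_zero]
  refine hasSum_eq_of_telescoping (((summable_aperyTerm hm).hasSum.mul_left _).sub
    (((summable_aperyTerm hm₁).hasSum.mul_left _).add
      ((summable_aperyTerm hm₂).hasSum.mul_left _))) hasSum_zero
    (by simpa only [neg_zero] using (tendsto_aperyCertificate_mul_aperyBase hm).neg) ?_ fun k => ?_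
  · rw [hcert, Nat.cast_zero]
    ring
  · rw [hcert]
    have hshift := mul_aperyBase_succ m k
    push_cast at hshift ⊢
    linear_combination (aperyCertificate m).eval ((k : ℂ) + 1) * hshift

theorem factorial_mul_poch (m k : ℕ) :
    (m.factorial : ℂ) * poch (m + 1) k = ((m + k).factorial : ℂ) := by
  induction k with
  | zero => simp
  | succ k ih =>
    rw [poch_succ, ← mul_assoc, ih, ← add_assoc, Nat.factorial_succ]
    push_cast
    ring

theorem factorial_pow_four_mul_aperyTerm (m k : ℕ) :
    (m.factorial : ℂ) ^ 4 * aperyTerm m k = m.factorial * ((m + k).factorial : ℂ) ^ 3 /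
      (((2 * m + 1 + k).factorial : ℂ) ^ 2 * k.factorial) := by
  have hGamma : Complex.Gamma (2 * m + 2 + k) = ((2 * m + 1 + k).factorial : ℂ) := by
    rw [← Complex.Gamma_nat_eq_factorial]
    congr 1
    push_cast
    ring
  rw [aperyTerm, regularizedTerm, ← factorial_mul_poch]
  simp only [List.map_cons, List.map_nil, List.prod_cons, List.prod_nil, hGamma, div_eq_mul_inv,
    mul_inv]
  ring

theorem aperyTerm_zero (k : ℕ) : aperyTerm 0 k = 1 / ((k : ℂ) + 1) ^ 2 := by
  have hk : (k.factorial : ℂ) ≠ 0 := by exact_mod_cast k.factorial_ne_zero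
  have hk₁ : (k : ℂ) + 1 ≠ 0 := by exact_mod_cast k.succ_ne_zero
  have h := factorial_pow_four_mul_aperyTerm 0 k
  rw [mul_zero, zero_add, zero_add, add_comm 1, Nat.factorial_succ] at h
  push_cast at h
  rw [Nat.factorial_zero, Nat.cast_one, one_pow, one_mul, one_mul] at h
  rw [h]
  field_simp

theorem natCast_add_natCast_succ_ne_zero (k n : ℕ) : (k : ℂ) + (n + 1 : ℕ) ≠ 0 := by
  exact_mod_cast (k + n).succ_ne_zero

theorem aperyTerm_one (k : ℕ) :
    aperyTerm 1 k = ((k : ℂ) + 1) / (((k : ℂ) + 2) ^ 2 * ((k : ℂ) + 3) ^ 2) := by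
  have hk : (k.factorial : ℂ) ≠ 0 := by exact_mod_cast k.factorial_ne_zero
  have hk₁ : (k : ℂ) + 1 ≠ 0 := by exact_mod_cast k.succ_ne_zero
  have hk₂ : (k : ℂ) + 2 ≠ 0 := natCast_add_natCast_succ_ne_zero k 1
  have hk₃ : (k : ℂ) + 3 ≠ 0 := natCast_add_natCast_succ_ne_zero k 2
  have h := factorial_pow_four_mul_aperyTerm 1 k
  rw [add_comm 1 k, show 2 * 1 + 1 + k = k + 1 + 1 + 1 by ring] at h
  simp only [Nat.factorial_succ, Nat.factorial_zero] at h
  push_cast at h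
  rw [add_assoc (k : ℂ) 1 1, one_add_one_eq_two, add_assoc (k : ℂ) 2 1, two_add_one_eq_three] at h
  simp only [one_mul, one_pow] at h
  rw [h]
  field_simp

theorem tsum_aperyTerm_zero : ∑' k, aperyTerm 0 k = riemannZeta 2 := by
  rw [zeta_eq_tsum_one_div_nat_add_one_cpow (by norm_num)]
  exact tsum_congr fun k => by rw [aperyTerm_zero]; norm_cast

theorem tsum_aperyTerm_one : ∑' k, aperyTerm 1 k = 5 - 3 * riemannZeta 2 := by
  have hlim (c : ℕ) : Tendsto (fun k : ℕ => 1 / ((k : ℂ) + c)) atTop (𝓝 0) :=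
    ((tendsto_const_div_atTop_nhds_zero_nat (1 : ℂ)).comp (tendsto_add_atTop_nat c)).congr
      fun k => by rw [Function.comp_apply, Nat.cast_add]
  have hcert : Tendsto (fun k : ℕ => 3 * (1 / ((k : ℂ) + (2 : ℕ))) +
      3 * (1 / ((k : ℂ) + (1 : ℕ))) ^ 2 + 2 * (1 / ((k : ℂ) + (2 : ℕ))) ^ 2) atTop (𝓝 0) := by
    simpa using (((hlim 2).const_mul 3).add (((hlim 1).pow 2).const_mul 3)).add
      (((hlim 2).pow 2).const_mul 2)
  have hsum : HasSum (fun k => aperyTerm 1 k + 3 * aperyTerm 0 k)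
      (∑' k, aperyTerm 1 k + 3 * ∑' k, aperyTerm 0 k) :=
    (summable_aperyTerm (by simp)).hasSum.add ((summable_aperyTerm (by simp)).hasSum.mul_left 3)
  have hfive := hasSum_eq_of_telescoping (hasSum_pi_single 0 (5 : ℂ)) hsum hcert
    (by norm_num) fun k => by
      have hk₁ : (k : ℂ) + 1 ≠ 0 := by exact_mod_cast k.succ_ne_zero
      have hk₂ : (k : ℂ) + 2 ≠ 0 := natCast_add_natCast_succ_ne_zero k 1
      have hk₃ : (k : ℂ) + 3 ≠ 0 := natCast_add_natCast_succ_ne_zero k 2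
      rw [Pi.single_eq_of_ne k.succ_ne_zero, aperyTerm_one, aperyTerm_zero]
      push_cast
      rw [add_assoc (k : ℂ) 1 1, add_assoc (k : ℂ) 1 2, one_add_one_eq_two,
        show (1 : ℂ) + 2 = 3 by norm_num]
      field_simp
      ring
  rw [← tsum_aperyTerm_zero]
  linear_combination -hfive

theorem aperySolution_add_two (u₀ u₁ : ℚ) (m : ℕ) :
    ((m : ℂ) + 2) ^ 2 * (aperySolution u₀ u₁ (m + 2) : ℂ) =
      (11 * ((m : ℂ) + 1) ^ 2 + 11 * ((m : ℂ) + 1) + 3) * (aperySolution u₀ u₁ (m + 1) : ℂ) +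
        ((m : ℂ) + 1) ^ 2 * (aperySolution u₀ u₁ m : ℂ) := by
  have hm : (m : ℂ) + 2 ≠ 0 := natCast_add_natCast_succ_ne_zero m 1
  rw [aperySolution]
  push_cast
  field_simp

theorem factorial_pow_four_mul_tsum_aperyTerm (m : ℕ) :
    (m.factorial : ℂ) ^ 4 * ∑' k, aperyTerm m k =
      (-1) ^ m * ((aperyDen m : ℂ) * riemannZeta 2 - (aperyNum m : ℂ)) := by
  induction m using Nat.twoStepInduction with
  | zero => simp [tsum_aperyTerm_zero, aperyDen, aperyNum, aperySolution]
  | one => simp [tsum_aperyTerm_one, aperyDen, aperyNum, aperySolution]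
  | more m ih₀ ih₁ =>
    have hm : (m : ℂ) + 2 ≠ 0 := natCast_add_natCast_succ_ne_zero m 1
    have h := tsum_aperyTerm_recurrence (m := m) (by
      rw [Complex.natCast_re]
      exact neg_one_lt_zero.trans_le m.cast_nonneg)
    have hden := aperySolution_add_two 1 3 m
    have hnum := aperySolution_add_two 0 5 m
    rw [← aperyDen] at hden
    rw [← aperyNum] at hnum
    simp only [Nat.factorial_succ] at ih₁ ⊢
    push_cast at ih₁ ⊢
    rw [add_assoc (m : ℂ) 1 1, one_add_one_eq_two]
    refine mul_left_cancel₀ (pow_ne_zero 2 hm) ?_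
    linear_combination -(m.factorial : ℂ) ^ 4 * h + ((m : ℂ) + 1) ^ 2 * ih₀ -
      (11 * ((m : ℂ) + 1) ^ 2 + 11 * ((m : ℂ) + 1) + 3) * ih₁ -
      (-1) ^ m * (riemannZeta 2 * hden - hnum)

/-! ### The well-poised approximations -/

theorem hypergeometricF_three_two_odd (n : ℕ) :
    Complex.Gamma (4 * n + 2) ^ 2 * Complex.Gamma (2 * n + 1) ^ 2 /
          Complex.Gamma (3 * n + 3 / 2) ^ 4 *
        hypergeometricF
          [4 * (n : ℂ) + 1, (n : ℂ) + 1 / 2, (n : ℂ) + 1 / 2, (n : ℂ) + 1 / 2, (n : ℂ) + 1 / 2]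
          [3 * (n : ℂ) + 3 / 2, 3 * (n : ℂ) + 3 / 2, 3 * (n : ℂ) + 3 / 2, 3 * (n : ℂ) + 3 / 2] 1 =
      hypergeometricF [2 * (n : ℂ) + 1, 2 * (n : ℂ) + 1, 2 * (n : ℂ) + 1]
        [4 * (n : ℂ) + 2, 4 * (n : ℂ) + 2] 1 := by
  have : (0 : ℝ) ≤ n := n.cast_nonneg
  have hfour : NotNonposInt (4 * (n : ℂ) + 2) := .of_re_pos (by simp; linarith)
  have hthree : NotNonposInt (3 * (n : ℂ) + 3 / 2) := .of_re_pos (by simp; linarith)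
  have htwo : (2 * (n : ℂ) + 1) ≠ 0 := by exact_mod_cast (2 * n).succ_ne_zero
  have h := hypergeometricF_three_two_eq_five_four (h := 2 * n + 1) (x := n + 1 / 2)
    (y := n + 1 / 2)
  ring_nf at h hfour hthree htwo ⊢
  rw [h (by simp; linarith) (by simp; linarith) htwo hfour hfour hthree hthree hthree hthree]

theorem wellPoisedR_eq_zero {n t : ℕ} (ht : t < n) : wellPoisedR n ((t : ℂ) + 1) = 0 := by
  have h : ∏ j ∈ Finset.range (4 * n), ((t : ℂ) + 1 - n + j) = 0 := by
    refine Finset.prod_eq_zero (i := n - 1 - t) (Finset.mem_range.2 (by omega)) ?_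
    rw [Nat.cast_sub (by omega), Nat.cast_sub (by omega)]
    push_cast
    ring
  rw [wellPoisedR, h, mul_zero, zero_div]

theorem Gamma_two_mul_natCast_add_one (n : ℕ) :
    Complex.Gamma (2 * n + 1) = ((2 * n).factorial : ℂ) := by
  rw [← Complex.Gamma_nat_eq_factorial, Nat.cast_mul, Nat.cast_ofNat]

theorem Gamma_four_mul_natCast_add_two (n : ℕ) :
    Complex.Gamma (4 * n + 2) = ((4 * n + 1).factorial : ℂ) := by
  rw [← Complex.Gamma_nat_eq_factorial]
  push_cast
  rw [add_assoc, one_add_one_eq_two]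

theorem two_pow_mul_factorial_mul_Gamma_add_half (n : ℕ) :
    2 ^ (2 * n) * (n.factorial * Complex.Gamma (n + 1 / 2)) = (2 * n).factorial * √Real.pi := by
  have h := Complex.Gamma_mul_Gamma_add_half ((n : ℂ) + 1 / 2)
  rw [show (n : ℂ) + 1 / 2 + 1 / 2 = n + 1 by ring, Complex.Gamma_nat_eq_factorial,
    show 2 * ((n : ℂ) + 1 / 2) = 2 * n + 1 by ring, Gamma_two_mul_natCast_add_one,
    show 1 - (2 * (n : ℂ) + 1) = -((2 * n : ℕ) : ℂ) by push_cast; ring, Complex.cpow_neg,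
    Complex.cpow_natCast] at h
  rw [mul_comm (n.factorial : ℂ), h]
  field_simp

theorem two_pow_mul_factorial_pow_four_mul_Gamma_add_half_pow_four (n : ℕ) :
    2 ^ (8 * n) * (n.factorial : ℂ) ^ 4 * Complex.Gamma (n + 1 / 2) ^ 4 =
      (Real.pi : ℂ) ^ 2 * ((2 * n).factorial : ℂ) ^ 4 := by
  have hpi : (√Real.pi : ℂ) ^ 2 = Real.pi := by
    rw [← Complex.ofReal_pow, Real.sq_sqrt Real.pi_pos.le]
  calc _ = (2 ^ (2 * n) * (n.factorial * Complex.Gamma (n + 1 / 2))) ^ 4 := by ring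
    _ = _ := by
      rw [two_pow_mul_factorial_mul_Gamma_add_half, ← hpi]
      ring

theorem factorial_mul_poch_comm (m k : ℕ) :
    (k.factorial : ℂ) * poch (k + 1) m = m.factorial * poch (m + 1) k := by
  rw [factorial_mul_poch, factorial_mul_poch, add_comm]

theorem poch_mul_inv_Gamma_add_add {a : ℂ} {k : ℕ} (ha : NotNonposInt (a + k)) (l : ℕ) :
    poch a k * (Complex.Gamma (a + k + l))⁻¹ = (Complex.Gamma a)⁻¹ * (poch (a + k) l)⁻¹ := by
  rw [Gamma_add_natCast ha, mul_inv, ← mul_assoc, poch_mul_inv_Gamma_add_natCast]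

theorem regularizedTerm_five_four_odd (n k : ℕ) :
    regularizedTerm
      [4 * (n : ℂ) + 1, (n : ℂ) + 1 / 2, (n : ℂ) + 1 / 2, (n : ℂ) + 1 / 2, (n : ℂ) + 1 / 2]
      [3 * (n : ℂ) + 3 / 2, 3 * (n : ℂ) + 3 / 2, 3 * (n : ℂ) + 3 / 2, 3 * (n : ℂ) + 3 / 2] k =
    poch (4 * n + 1) k * (k.factorial : ℂ)⁻¹ *
      ((Complex.Gamma (n + 1 / 2))⁻¹ * (poch (n + 1 / 2 + k) (2 * n + 1))⁻¹) ^ 4 := by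
  have hhalf : NotNonposInt ((n : ℂ) + 1 / 2 + k) := .of_re_pos <| by
    simp only [one_div, Complex.add_re, Complex.natCast_re, Complex.inv_re, Complex.re_ofNat,
      Complex.normSq_ofNat, div_self_mul_self']
    positivity
  have hshift : (n : ℂ) + 1 / 2 + k + (2 * n + 1 : ℕ) = 3 * n + 3 / 2 + k := by
    push_cast
    ring
  rw [← poch_mul_inv_Gamma_add_add hhalf, hshift]
  simp only [regularizedTerm, List.map_cons, List.map_nil, List.prod_cons, List.prod_nil]
  ring

theorem wellPoisedR_add_add_one (n k : ℕ) : wellPoisedR n (((k + n : ℕ) : ℂ) + 1) =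
    (Real.pi : ℂ) ^ 2 * ((2 * n).factorial : ℂ) ^ 6 *
      regularizedTerm
        [4 * (n : ℂ) + 1, (n : ℂ) + 1 / 2, (n : ℂ) + 1 / 2, (n : ℂ) + 1 / 2, (n : ℂ) + 1 / 2]
        [3 * (n : ℂ) + 3 / 2, 3 * (n : ℂ) + 3 / 2, 3 * (n : ℂ) + 3 / 2,
          3 * (n : ℂ) + 3 / 2] k := by
  have hk : (k.factorial : ℂ) ≠ 0 := by exact_mod_cast k.factorial_ne_zero
  have hn : ((4 * n).factorial : ℂ) ≠ 0 := by exact_mod_cast (4 * n).factorial_ne_zero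
  have hGamma : Complex.Gamma ((n : ℂ) + 1 / 2) ≠ 0 := by
    refine (NotNonposInt.of_re_pos ?_).Gamma_ne_zero
    simp only [one_div, Complex.add_re, Complex.natCast_re, Complex.inv_re, Complex.re_ofNat,
      Complex.normSq_ofNat, div_self_mul_self']
    positivity
  have hnum : ∏ j ∈ Finset.range (4 * n), (((k + n : ℕ) : ℂ) + 1 - n + j) =
      (4 * n).factorial * (poch (4 * n + 1) k * (k.factorial : ℂ)⁻¹) := by
    have h := factorial_mul_poch_comm (4 * n) k
    rw [Nat.cast_mul, Nat.cast_ofNat] at h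
    rw [← mul_assoc, ← h, mul_right_comm, mul_inv_cancel₀ hk, one_mul, ← prod_range_add_eq_poch]
    refine Finset.prod_congr rfl fun j _ => ?_
    push_cast
    ring
  have hden : ∏ j ∈ Finset.range (2 * n + 1), (((k + n : ℕ) : ℂ) + 1 - 1 / 2 + j) ^ 4 =
      poch (n + 1 / 2 + k) (2 * n + 1) ^ 4 := by
    rw [Finset.prod_pow, ← prod_range_add_eq_poch]
    refine congrArg (· ^ 4) (Finset.prod_congr rfl fun j _ => ?_)
    push_cast
    ring
  have hpi : 2 ^ (8 * n) * (n.factorial : ℂ) ^ 4 = (Real.pi : ℂ) ^ 2 *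
      ((2 * n).factorial : ℂ) ^ 4 * (Complex.Gamma (n + 1 / 2))⁻¹ ^ 4 := by
    rw [← two_pow_mul_factorial_pow_four_mul_Gamma_add_half_pow_four, mul_assoc _ _ (_⁻¹ ^ 4),
      ← mul_pow, mul_inv_cancel₀ hGamma, one_pow, mul_one]
  rw [regularizedTerm_five_four_odd, wellPoisedR, hnum, hden, hpi, mul_left_comm,
    mul_div_mul_left _ _ hn, div_eq_mul_inv]
  ring

theorem hasSum_wellPoisedR (n : ℕ) : HasSum (fun t : ℕ => wellPoisedR n ((t : ℂ) + 1))
    ((Real.pi : ℂ) ^ 2 * Complex.Gamma (2 * n + 1) ^ 6 / Complex.Gamma (3 * n + 3 / 2) ^ 4 *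
      hypergeometricF
        [4 * (n : ℂ) + 1, (n : ℂ) + 1 / 2, (n : ℂ) + 1 / 2, (n : ℂ) + 1 / 2, (n : ℂ) + 1 / 2]
        [3 * (n : ℂ) + 3 / 2, 3 * (n : ℂ) + 3 / 2, 3 * (n : ℂ) + 3 / 2,
          3 * (n : ℂ) + 3 / 2] 1) := by
  have : (0 : ℝ) ≤ n := n.cast_nonneg
  have hthree : NotNonposInt (3 * (n : ℂ) + 3 / 2) := .of_re_pos (by simp; linarith)
  have hsum := (summable_regularizedTerm
    (as := [4 * (n : ℂ) + 1, (n : ℂ) + 1 / 2, (n : ℂ) + 1 / 2, (n : ℂ) + 1 / 2, (n : ℂ) + 1 / 2])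
    (bs := [3 * (n : ℂ) + 3 / 2, 3 * (n : ℂ) + 3 / 2, 3 * (n : ℂ) + 3 / 2, 3 * (n : ℂ) + 3 / 2])
    rfl (by simp; linarith)).hasSum.mul_left ((Real.pi : ℂ) ^ 2 * ((2 * n).factorial : ℂ) ^ 6)
  have hGamma (c s : ℂ) : c / Complex.Gamma (3 * n + 3 / 2) ^ 4 *
      (([3 * (n : ℂ) + 3 / 2, 3 * (n : ℂ) + 3 / 2, 3 * (n : ℂ) + 3 / 2,
        3 * (n : ℂ) + 3 / 2].map Complex.Gamma).prod * s) = c * s := by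
    have hne := hthree.Gamma_ne_zero
    simp only [List.map_cons, List.map_nil, List.prod_cons, List.prod_nil]
    generalize Complex.Gamma (3 * n + 3 / 2) = G at hne ⊢
    field_simp
  rw [← hasSum_nat_add_iff' n, Finset.sum_eq_zero fun t ht =>
    wellPoisedR_eq_zero (Finset.mem_range.1 ht), sub_zero]
  simp only [wellPoisedR_add_add_one]
  rwa [hypergeometricF_one_eq (by simp [hthree]), Gamma_two_mul_natCast_add_one, hGamma]

theorem wellPoisedForm_eq_three_two (n : ℕ) : wellPoisedForm n =
    (Real.pi : ℂ) ^ 2 * ((2 * n).factorial : ℂ) ^ 4 / ((4 * n + 1).factorial : ℂ) ^ 2 *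
      hypergeometricF [2 * (n : ℂ) + 1, 2 * (n : ℂ) + 1, 2 * (n : ℂ) + 1]
        [4 * (n : ℂ) + 2, 4 * (n : ℂ) + 2] 1 := by
  have hn : ((4 * n + 1).factorial : ℂ) ≠ 0 := by exact_mod_cast (4 * n + 1).factorial_ne_zero
  rw [wellPoisedForm, (hasSum_wellPoisedR n).tsum_eq, ← hypergeometricF_three_two_odd,
    Gamma_two_mul_natCast_add_one, Gamma_four_mul_natCast_add_two]
  field_simp

theorem hypergeometricF_three_two_eq_tsum_aperyTerm (n : ℕ) :
    hypergeometricF [2 * (n : ℂ) + 1, 2 * (n : ℂ) + 1, 2 * (n : ℂ) + 1]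
        [4 * (n : ℂ) + 2, 4 * (n : ℂ) + 2] 1 =
      ((4 * n + 1).factorial : ℂ) ^ 2 * ∑' k, aperyTerm (2 * n : ℕ) k := by
  have hfour : NotNonposInt (4 * (n : ℂ) + 2) := .of_re_pos <| by
    simp only [Complex.add_re, Complex.mul_re, Complex.re_ofNat, Complex.natCast_re,
      Complex.im_ofNat, Complex.natCast_im, mul_zero, sub_zero]
    positivity
  rw [hypergeometricF_one_eq (by simp [hfour])]
  simp only [List.map_cons, List.map_nil, List.prod_cons, List.prod_nil, aperyTerm,
    Gamma_four_mul_natCast_add_two, Nat.cast_mul, Nat.cast_ofNat]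
  ring_nf

theorem wellPoisedForm_eq_apery (n : ℕ) : wellPoisedForm n =
    (Real.pi : ℂ) ^ 2 *
      ((aperyDen (2 * n) : ℂ) * riemannZeta 2 - (aperyNum (2 * n) : ℂ)) := by
  have h := factorial_pow_four_mul_tsum_aperyTerm (2 * n)
  rw [(even_two_mul n).neg_one_pow, one_mul] at h
  have hn : ((4 * n + 1).factorial : ℂ) ≠ 0 := by exact_mod_cast (4 * n + 1).factorial_ne_zero
  rw [wellPoisedForm_eq_three_two, hypergeometricF_three_two_eq_tsum_aperyTerm, ← h]
  field_simp

end

theorem mainTheorem5 :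
    (∀ a b c : ℂ,
      -- convergence of the two series at `1`
      0 < (-3 * a + 2 * b + 2 * c).re →
      0 < (-2 * a + 2 * b + 2 * c + 1).re →
      -- the lower parameters are admissible
      NotNonposInt (-a + 2 * b + c) →
      NotNonposInt (-a + b + 2 * c) →
      NotNonposInt (-(3 * a / 2) + 2 * b + c) →
      NotNonposInt (-(a / 2) + b + c) →
      NotNonposInt (-(5 * a / 2) + 2 * b + 2 * c) →
      NotNonposInt (-(3 * a / 2) + b + 2 * c) →
      -- the Gamma functions in the numerators have no poles
      NotNonposInt (-(a / 2) + b + c + 1 / 2) →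
      NotNonposInt (-(3 * a / 2) + 2 * b + c + 1 / 2) →
      NotNonposInt (-2 * a + 2 * b + 2 * c) →
      NotNonposInt (-2 * a + 4 * b + 2 * c) →
      Summable (hypergeometricTerm [a, b, c] [-a + 2 * b + c, -a + b + 2 * c] 1) ∧
      Summable (hypergeometricTerm
        [-2 * a + 2 * b + 2 * c - 1, c - a / 2, -(3 * a / 2) + b + c, a / 2, b - a / 2]
        [-(3 * a / 2) + 2 * b + c, -(a / 2) + b + c, -(5 * a / 2) + 2 * b + 2 * c,
          -(3 * a / 2) + b + 2 * c] 1) ∧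
      hypergeometricF [a, b, c] [-a + 2 * b + c, -a + b + 2 * c] 1 =
        (Complex.Gamma (-(a / 2) + b + c + 1 / 2) *
            Complex.Gamma (-(3 * a / 2) + 2 * b + c + 1 / 2)) /
          (Complex.Gamma (-a + b + c + 1 / 2) * Complex.Gamma (-a + 2 * b + c + 1 / 2)) *
        ((Complex.Gamma (-a + b + 2 * c) * Complex.Gamma (-3 * a + 2 * b + 2 * c) *
            Complex.Gamma (-2 * a + 2 * b + 2 * c) * Complex.Gamma (-2 * a + 4 * b + 2 * c)) /
          (Complex.Gamma (-(3 * a / 2) + b + 2 * c) *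
            Complex.Gamma (-(5 * a / 2) + 2 * b + 2 * c) *
            Complex.Gamma (-a + 2 * b + 2 * c) * Complex.Gamma (-3 * a + 4 * b + 2 * c))) *
        hypergeometricF
          [-2 * a + 2 * b + 2 * c - 1, c - a / 2, -(3 * a / 2) + b + c, a / 2, b - a / 2]
          [-(3 * a / 2) + 2 * b + c, -(a / 2) + b + c, -(5 * a / 2) + 2 * b + 2 * c,
            -(3 * a / 2) + b + 2 * c] 1) ∧
    (∀ n : ℕ,
      -- the case `a = b = c = 2n + 1`
      Complex.Gamma (4 * n + 2) ^ 2 * Complex.Gamma (2 * n + 1) ^ 2 /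
            Complex.Gamma (3 * n + 3 / 2) ^ 4 *
          hypergeometricF
            [4 * (n : ℂ) + 1, (n : ℂ) + 1 / 2, (n : ℂ) + 1 / 2, (n : ℂ) + 1 / 2, (n : ℂ) + 1 / 2]
            [3 * (n : ℂ) + 3 / 2, 3 * (n : ℂ) + 3 / 2, 3 * (n : ℂ) + 3 / 2, 3 * (n : ℂ) + 3 / 2] 1 =
        hypergeometricF [2 * (n : ℂ) + 1, 2 * (n : ℂ) + 1, 2 * (n : ℂ) + 1]
          [4 * (n : ℂ) + 2, 4 * (n : ℂ) + 2] 1 ∧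
      -- the well-poised approximations `r_n`
      Summable (fun t : ℕ => wellPoisedR n ((t : ℂ) + 1)) ∧
      wellPoisedForm n =
        (Real.pi : ℂ) ^ 2 * Complex.Gamma (2 * n + 1) ^ 6 / Complex.Gamma (3 * n + 3 / 2) ^ 4 *
          hypergeometricF
            [4 * (n : ℂ) + 1, (n : ℂ) + 1 / 2, (n : ℂ) + 1 / 2, (n : ℂ) + 1 / 2, (n : ℂ) + 1 / 2]
            [3 * (n : ℂ) + 3 / 2, 3 * (n : ℂ) + 3 / 2, 3 * (n : ℂ) + 3 / 2, 3 * (n : ℂ) + 3 / 2] 1 ∧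
      wellPoisedForm n =
        (Real.pi : ℂ) ^ 2 * ((2 * n).factorial : ℂ) ^ 4 / ((4 * n + 1).factorial : ℂ) ^ 2 *
          hypergeometricF [2 * (n : ℂ) + 1, 2 * (n : ℂ) + 1, 2 * (n : ℂ) + 1]
            [4 * (n : ℂ) + 2, 4 * (n : ℂ) + 2] 1 ∧
      wellPoisedForm n =
        (Real.pi : ℂ) ^ 2 *
          ((aperyDen (2 * n) : ℂ) * riemannZeta 2 - (aperyNum (2 * n) : ℂ))) := by
  refine ⟨fun a b c => ?_, fun n => ⟨hypergeometricF_three_two_odd n,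
    (hasSum_wellPoisedR n).summable, (hasSum_wellPoisedR n).tsum_eq,
    wellPoisedForm_eq_three_two n, wellPoisedForm_eq_apery n⟩⟩
  have key := summable_and_hypergeometricF_three_two_eq_five_four (-a + b + c) (c - a / 2) (a / 2)
  ring_nf at key ⊢
  exact key
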